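/- All vector spaces are finite-dimensional over $\mathbb C$. For $X\subset\mathbb P(\mathcal H)$ spanning $\mathbb P(\mathcal H)$, let $\mathrm{rk}_X[\psi]$ be the least $r$ such that $\psi=x_1+\dots+x_r$ with $[x_j]\in X$, let $X_r$ be the set of states of rank exactly $r$, and let the border rank $\underline{\mathrm{rk}}_X[\psi]$ be the least $r$ such that $[\psi]$ lies in the Zariski closure of $X_r$. Let $\sigma_r(X)$ be the Zariski closure of the union of the projective subspaces spanned by $r$ points of $X$. A state $[\psi]$ is *exceptional* if $\mathrm{rk}_X[\psi]\neq\underline{\mathrm{rk}}_X[\psi]$. **Theorem.** Let $L\ge 3$, and consider one of the following configurations: (i) $\mathcal H=\mathcal H_1\otimes\dots\otimes\mathcal H_L$ with $\dim\mathcal H_j\ge 2$ for all $j$, and $X$ the Segre variety of all $[v_1\otimes\dots\otimes v_L]$ with $0\ne v_j\in\mathcal H_j$; (ii) $\mathcal H=S^L(\mathcal H_1)$ with $\dim\mathcal H_1\ge 2$, and $X$ the Veronese variety of all $[v^L]$ with $0\ne v\in\mathcal H_1$; (iii) $\mathcal H=\bigwedge^L\mathcal H_1$ with $n=\dim\mathcal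 H_1$ and $n-L\ge 3$ (so $n\ge 6$), and $X$ the Grassmann variety of all $[u_1\wedge\dots\wedge u_L]$ with $u_1,\dots,u_L\in\mathcal H_1$ linearly independent. Then there is an exceptional state in $\mathbb P(\mathcal H)$ which lies in the second secant variety $\sigma_2(X)$; its border rank is strictly smaller than its rank, that is, it can be approximated by states of lower rank. Moreover: - in case (i) with $L=3$, if $e_j,f_j\in\mathcal H_j$ are linearly independent for $j=1,2,3$, the state $W=[f_1\otimes e_2\otimes e_3+e_1\otimes f_2\otimes e_3+e_1\otimes e_2\otimes f_3]$ has rank $3$ and border rank $2$; - in case (ii), if $u,w\in\mathcal H_1$ are linearly independent, the state $[u\,w^{L-1}]$ has rank $L$ and border rank $2$; - in case (iii) with $L=3$, if $v_1,\dots,v_6\in\mathcal H_1$ are linearly independent, the state $[v_1\wedge v_2\wedge v_4-v_1\wedge v_3\wedge v_5+v_2\wedge v_3\wedge v_6]$ has rank $3$ and border rank $2$. -/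

import Mathlib

open scoped TensorProduct LinearAlgebra.Projectivization

noncomputable section

/-! ### Zariski closure, rank, border rank and secant varieties in a projective space `ℙ ℂ E` -/

section General

variable {E : Type*} [AddCommGroup E] [Module ℂ E]

/-- The value at `v : E` of a polynomial expression `F` in linear functionals on `E`. For finite
dimensional `E` these expressions give exactly the polynomial functions on `E`. -/
def polyValue (F : MvPolynomial (Module.Dual ℂ E) ℂ) (v : E) : ℂ :=
  MvPolynomial.eval (fun f : Module.Dual ℂ E => f v) F

/-- `F` vanishes at every nonzero vector representing the point `p`. -/
def VanishesAt (F : MvPolynomial (Module.Dual ℂ E) ℂ) (p : ℙ ℂ E) : Prop :=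
  ∀ (v : E) (hv : v ≠ 0), Projectivization.mk ℂ v hv = p → polyValue F v = 0

/-- The Zariski closure of a set of points of projective space: the common zeros of all
homogeneous polynomials vanishing on the set. -/
def zariskiClosure (S : Set (ℙ ℂ E)) : Set (ℙ ℂ E) :=
  {p | ∀ (d : ℕ) (F : MvPolynomial (Module.Dual ℂ E) ℂ), F.IsHomogeneous d →
    (∀ q ∈ S, VanishesAt F q) → VanishesAt F p}

/-- The rank of a state `p = [ψ]` with respect to `X`: the least `r` such that
`ψ = x₁ + ⋯ + x_r` with nonzero vectors `x_j` satisfying `[x_j] ∈ X`. (Such `r` exists for every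
`p` as soon as `X` spans the projective space.) -/
def stateRank (X : Set (ℙ ℂ E)) (p : ℙ ℂ E) : ℕ :=
  sInf {r : ℕ | ∃ (x : Fin r → E) (h : ∑ j, x j ≠ 0),
    (∀ j, ∃ hj : x j ≠ 0, Projectivization.mk ℂ (x j) hj ∈ X) ∧
      Projectivization.mk ℂ (∑ j, x j) h = p}

/-- The set `X_r` of states of rank exactly `r`. -/
def rankSubset (X : Set (ℙ ℂ E)) (r : ℕ) : Set (ℙ ℂ E) :=
  {p | stateRank X p = r}

/-- The border rank of `p`: the least `r` such that `p` lies in the Zariski closure of `X_r`. -/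
def stateBorderRank (X : Set (ℙ ℂ E)) (p : ℙ ℂ E) : ℕ :=
  sInf {r : ℕ | p ∈ zariskiClosure (rankSubset X r)}

/-- A state is exceptional if its rank and its border rank differ. -/
def IsExceptional (X : Set (ℙ ℂ E)) (p : ℙ ℂ E) : Prop :=
  stateRank X p ≠ stateBorderRank X p

/-- The `r`-th secant variety of `X`: the Zariski closure of the union of the projective
subspaces spanned by `r` points of `X`. -/
def secantVariety (X : Set (ℙ ℂ E)) (r : ℕ) : Set (ℙ ℂ E) :=
  zariskiClosure {p | ∃ x : Fin r → ℙ ℂ E,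
    (∀ i, x i ∈ X) ∧ p.submodule ≤ ⨆ i, (x i).submodule}

end General

/-! ### The varieties of coherent states -/

/-- The Segre variety in `ℙ(H₁ ⊗ ⋯ ⊗ H_L)`: the points `[v₁ ⊗ ⋯ ⊗ v_L]`. -/
def segreVariety {L : ℕ} (H : Fin L → Type*) [∀ j, AddCommGroup (H j)] [∀ j, Module ℂ (H j)] :
    Set (ℙ ℂ (⨂[ℂ] j, H j)) :=
  {p | ∃ (v : ∀ j, H j) (h : PiTensorProduct.tprod ℂ v ≠ 0),
    Projectivization.mk ℂ (PiTensorProduct.tprod ℂ v) h = p}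

/-- The Veronese variety in `ℙ(S^L V)`: the points `[v^L]`. -/
def veroneseVariety (L : ℕ) (V : Type*) [AddCommGroup V] [Module ℂ V] :
    Set (ℙ ℂ (SymmetricPower ℂ (Fin L) V)) :=
  {p | ∃ (v : V) (h : SymmetricPower.tprod ℂ (fun _ : Fin L => v) ≠ 0),
    Projectivization.mk ℂ (SymmetricPower.tprod ℂ (fun _ : Fin L => v)) h = p}

/-- The Grassmann variety in its Plücker embedding in `ℙ(⋀^L V)`: the points
`[u₁ ∧ ⋯ ∧ u_L]` with `u₁, …, u_L` a basis of an `L`-dimensional subspace of `V`. -/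
def grassmannVariety (L : ℕ) (V : Type*) [AddCommGroup V] [Module ℂ V] :
    Set (ℙ ℂ (⋀[ℂ]^L V)) :=
  {p | ∃ (u : Fin L → V) (_ : LinearIndependent ℂ u) (h : exteriorPower.ιMulti ℂ L u ≠ 0),
    Projectivization.mk ℂ (exteriorPower.ιMulti ℂ L u) h = p}

/-! ### The W state and its bosonic and fermionic analogues -/

/-- `W = f₁ ⊗ e₂ ⊗ e₃ + e₁ ⊗ f₂ ⊗ e₃ + e₁ ⊗ e₂ ⊗ f₃`. -/
def wState {H : Fin 3 → Type*} [∀ j, AddCommGroup (H j)] [∀ j, Module ℂ (H j)]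
    (e f : ∀ j, H j) : ⨂[ℂ] j, H j :=
  ∑ k, PiTensorProduct.tprod ℂ (Function.update e k (f k))

/-- The symmetric tensor `u w^(L-1)` (for `1 ≤ L`). -/
def bosonicWState (L : ℕ) {V : Type*} [AddCommGroup V] [Module ℂ V] (u w : V) :
    SymmetricPower ℂ (Fin L) V :=
  SymmetricPower.tprod ℂ (fun i : Fin L => if (i : ℕ) = 0 then u else w)

/-- `v₁ ∧ v₂ ∧ v₄ - v₁ ∧ v₃ ∧ v₅ + v₂ ∧ v₃ ∧ v₆`; the family `v` is indexed from `0`. -/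
def fermionicWState {V : Type*} [AddCommGroup V] [Module ℂ V] (v : Fin 6 → V) : ⋀[ℂ]^3 V :=
  exteriorPower.ιMulti ℂ 3 ![v 0, v 1, v 3] - exteriorPower.ιMulti ℂ 3 ![v 0, v 2, v 4]
    + exteriorPower.ιMulti ℂ 3 ![v 1, v 2, v 5]

end

/-! In each case the cone `C` over `X` is the set of values of a multilinear map `M` (restricted to
the diagonal for bosons). The exceptional state is a tangent vector to `C`: the velocity at `t = 0`
of a curve `c t = M (e + t • f)` in `C`. It is the limit of the secants `(c t - c 0) / t`, each a
sum of two elements of `C`, so it lies in `σ₂(X)`. Border rank is defined through states of rank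
exactly `r`, so a quadric is also needed that vanishes on `C` but not at the tangent vector. It
shows that all but finitely many secants have rank exactly 2, and it keeps the tangent vector out of
the closure of `X₁`. This is `IsSpanningCone.tangent`.

What remains is a lower bound for the rank. Distinguishable particles and fermions share one
argument, `WCoordinates.three_le`. A few linear coordinates satisfy relations of Plücker type on
`C`, and these are incompatible with writing the W state as a sum of two elements of `C`. The
relations hold factor by factor for product vectors (`productFunctional_mul`) and are three-term
Plücker relations for decomposable vectors (`minorFunctional_pluecker`).

For bosons the rank is `L`. Two functionals turn a decomposition of `u w^(L-1)` into one of the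
polynomial `X` as a sum of `L`-th powers of linear forms, which needs `L` terms
(`le_of_sum_pow_eq_X`). A roots of unity filter gives a decomposition with `L` terms. -/

/-! ### Sums of nonzero elements of a cone -/

section Sums

variable {E : Type*} [AddCommGroup E]

/-- `ψ` is a sum of `r` nonzero elements of `C`. -/
def IsSumOf (C : Set E) (r : ℕ) (ψ : E) : Prop :=
  ∃ x : Fin r → E, (∀ j, x j ∈ C ∧ x j ≠ 0) ∧ ∑ j, x j = ψ

theorem IsSumOf.mem {C : Set E} {ψ : E} (h : IsSumOf C 1 ψ) : ψ ∈ C := by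
  obtain ⟨x, hx, rfl⟩ := h
  simpa using (hx 0).1

theorem IsSumOf.two_le {C : Set E} {ψ : E} (hψ : ψ ≠ 0) (hC : ψ ∉ C) {r : ℕ}
    (h : IsSumOf C r ψ) : 2 ≤ r := by
  match r, h with
  | 0, ⟨x, _, hx⟩ => exact absurd (by simpa using hx.symm) hψ
  | 1, h => exact absurd h.mem hC
  | r + 2, _ => omega

end Sums

/-! ### Rank, Zariski closure and tangents for a spanning cone -/

section Cones

variable {E : Type*} [AddCommGroup E] [Module ℂ E]

/-- The points of projective space represented by the nonzero vectors of `C`. -/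
def projectivized (C : Set E) : Set (ℙ ℂ E) :=
  {p | ∃ (x : E) (h : x ≠ 0), x ∈ C ∧ Projectivization.mk ℂ x h = p}

/-- A set of vectors which is closed under scalar multiplication and spans the whole space. -/
structure IsSpanningCone (C : Set E) : Prop where
  smul_mem : ∀ (a : ℂ) (x : E), x ∈ C → a • x ∈ C
  span_eq_top : Submodule.span ℂ C = ⊤

theorem IsSpanningCone.mk_mem_projectivized {C : Set E} (hC : IsSpanningCone C) {x : E}
    (h : x ≠ 0) : Projectivization.mk ℂ x h ∈ projectivized C ↔ x ∈ C := by
  constructor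
  · rintro ⟨y, hy, hyC, e⟩
    obtain ⟨a, ha⟩ := (Projectivization.mk_eq_mk_iff' ℂ _ _ _ _).1 e.symm
    exact ha ▸ hC.smul_mem a y hyC
  · exact fun hx => ⟨x, h, hx, rfl⟩

theorem IsSpanningCone.isSumOf_smul {C : Set E} (hC : IsSpanningCone C) {r : ℕ} {ψ : E}
    {a : ℂ} (ha : a ≠ 0) (h : IsSumOf C r ψ) : IsSumOf C r (a • ψ) := by
  obtain ⟨x, hx, rfl⟩ := h
  exact ⟨fun j => a • x j, fun j => ⟨hC.smul_mem _ _ (hx j).1, smul_ne_zero ha (hx j).2⟩,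
    Finset.smul_sum.symm⟩

theorem IsSpanningCone.exists_isSumOf {C : Set E} (hC : IsSpanningCone C) (ψ : E) :
    ∃ r, IsSumOf C r ψ := by
  have hψ : ψ ∈ Submodule.span ℂ C := hC.span_eq_top ▸ Submodule.mem_top
  have h0 : IsSumOf C 0 0 := ⟨Fin.elim0, fun j => j.elim0, by simp⟩
  induction hψ using Submodule.span_induction with
  | mem x hx =>
    by_cases h : x = 0
    · exact ⟨0, h ▸ h0⟩
    · exact ⟨1, fun _ => x, fun _ => ⟨hx, h⟩, by simp⟩
  | zero => exact ⟨0, h0⟩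
  | add x y _ _ hx hy =>
    obtain ⟨r, a, ha, rfl⟩ := hx
    obtain ⟨s, b, hb, rfl⟩ := hy
    refine ⟨r + s, Fin.append a b, fun j => ?_, by simp [Fin.sum_univ_add]⟩
    refine Fin.addCases (fun i => ?_) (fun i => ?_) j
    · simpa using ha i
    · simpa using hb i
  | smul a x _ hx =>
    by_cases h : a = 0
    · exact ⟨0, by simpa [h] using h0⟩
    · exact hx.imp fun r hr => hC.isSumOf_smul h hr

theorem IsSpanningCone.stateRank_eq_sInf {C : Set E} (hC : IsSpanningCone C) {ψ : E} (hψ : ψ ≠ 0) :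
    stateRank (projectivized C) (Projectivization.mk ℂ ψ hψ) = sInf {r | IsSumOf C r ψ} := by
  unfold stateRank
  congr 1
  ext r
  constructor
  · rintro ⟨x, h, hx, e⟩
    obtain ⟨a, ha⟩ := (Projectivization.mk_eq_mk_iff ℂ _ _ _ _).1 e.symm
    rw [Set.mem_ofPred_eq, ← ha]
    refine hC.isSumOf_smul a.ne_zero ⟨x, fun j => ?_, rfl⟩
    obtain ⟨hj, hjX⟩ := hx j
    exact ⟨(hC.mk_mem_projectivized hj).1 hjX, hj⟩
  · rintro ⟨x, hx, rfl⟩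
    exact ⟨x, hψ, fun j => ⟨(hx j).2, (hC.mk_mem_projectivized _).2 (hx j).1⟩, rfl⟩

theorem IsSpanningCone.stateRank_le {C : Set E} (hC : IsSpanningCone C) {ψ : E} (hψ : ψ ≠ 0)
    {r : ℕ} (h : IsSumOf C r ψ) :
    stateRank (projectivized C) (Projectivization.mk ℂ ψ hψ) ≤ r := by
  rw [hC.stateRank_eq_sInf]
  exact Nat.sInf_le h

/-- The infimum of an empty set of naturals is `0`, so a lower bound needs some decomposition to
exist. This is where the spanning hypothesis enters. -/
theorem IsSpanningCone.le_stateRank {C : Set E} (hC : IsSpanningCone C) {ψ : E} (hψ : ψ ≠ 0)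
    {m : ℕ} (h : ∀ r, IsSumOf C r ψ → m ≤ r) :
    m ≤ stateRank (projectivized C) (Projectivization.mk ℂ ψ hψ) := by
  rw [hC.stateRank_eq_sInf]
  exact h _ (Nat.sInf_mem (s := {r | IsSumOf C r ψ}) (hC.exists_isSumOf ψ))

theorem polyValue_smul {F : MvPolynomial (Module.Dual ℂ E) ℂ} {d : ℕ} (hF : F.IsHomogeneous d)
    (a : ℂ) (v : E) : polyValue F (a • v) = a ^ d * polyValue F v := by
  unfold polyValue
  rw [MvPolynomial.eval_eq, MvPolynomial.eval_eq, Finset.mul_sum]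
  refine Finset.sum_congr rfl fun m hm => ?_
  have hd : ∑ i ∈ m.support, m i = d := by
    rw [← hF (MvPolynomial.mem_support_iff.1 hm)]
    simp [Finsupp.weight_apply, Finsupp.sum]
  simp only [map_smul, smul_eq_mul, mul_pow, Finset.prod_mul_distrib, Finset.prod_pow_eq_pow_sum, hd]
  ring

theorem vanishesAt_mk_iff {F : MvPolynomial (Module.Dual ℂ E) ℂ} {d : ℕ} (hF : F.IsHomogeneous d)
    {v : E} (hv : v ≠ 0) : VanishesAt F (Projectivization.mk ℂ v hv) ↔ polyValue F v = 0 := by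
  refine ⟨fun h => h v hv rfl, fun h w hw e => ?_⟩
  obtain ⟨a, rfl⟩ := (Projectivization.mk_eq_mk_iff' ℂ _ _ _ _).1 e
  rw [polyValue_smul hF, h, mul_zero]

theorem zariskiClosure_empty : zariskiClosure (∅ : Set (ℙ ℂ E)) = ∅ := by
  refine Set.eq_empty_of_forall_notMem fun p hp => ?_
  have := hp 0 1 (MvPolynomial.isHomogeneous_one _ _) (by simp) p.rep p.rep_nonzero p.mk_rep
  simp [polyValue] at this

/-- The values of a polynomial along a polynomial curve are given by a univariate polynomial. -/
theorem exists_polynomial_polyValue (a : ℕ → E) (n : ℕ) (F : MvPolynomial (Module.Dual ℂ E) ℂ) :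
    ∃ P : Polynomial ℂ, ∀ t, P.eval t = polyValue F (∑ i ∈ Finset.range n, t ^ i • a i) := by
  refine ⟨MvPolynomial.aeval (fun f : Module.Dual ℂ E => ∑ i ∈ Finset.range n,
    Polynomial.C (f (a i)) * Polynomial.X ^ i) F, fun t => ?_⟩
  rw [← Polynomial.coe_evalRingHom, polyValue, MvPolynomial.aeval_def, MvPolynomial.hom_eval₂]
  refine congrArg₂ (fun g h => MvPolynomial.eval₂ g h F) (RingHom.ext fun z => by simp)
    (funext fun f => ?_)
  simp only [map_sum, map_mul, map_pow, Polynomial.coe_evalRingHom, Polynomial.eval_C,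
    Polynomial.eval_X, map_smul, smul_eq_mul]
  exact Finset.sum_congr rfl fun i _ => mul_comm _ _

/-- A form vanishing on `S` restricts to a polynomial in `t` with zeros wherever `Q` is nonzero. It
is therefore identically zero, in particular at `t = 0`. -/
theorem mk_mem_zariskiClosure_of_curve {S : Set (ℙ ℂ E)} {a : ℕ → E} {n : ℕ} (h0 : a 0 ≠ 0)
    {Q : Polynomial ℂ} (hQ : Q ≠ 0)
    (h : ∀ t, Q.eval t ≠ 0 → ∃ hne : ∑ i ∈ Finset.range (n + 1), t ^ i • a i ≠ 0,
      Projectivization.mk ℂ _ hne ∈ S) :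
    Projectivization.mk ℂ (a 0) h0 ∈ zariskiClosure S := by
  intro d F hF hS
  rw [vanishesAt_mk_iff hF]
  obtain ⟨P, hP⟩ := exists_polynomial_polyValue a (n + 1) F
  have hz : Q * P = 0 := by
    refine Polynomial.funext fun t => ?_
    by_cases ht : Q.eval t = 0
    · simp [ht]
    · obtain ⟨hne, hm⟩ := h t ht
      have := (vanishesAt_mk_iff hF hne).1 (hS _ hm)
      simp [hP, this]
  have h1 := hP 0
  rw [(mul_eq_zero.1 hz).resolve_left hQ, Finset.sum_range_succ'] at h1
  simpa using h1.symm

/-- The coefficient `a 1` is the value at `t = 0` of the polynomial curve of secants `γ t = (c t - c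
0) / t`. The form `F` separates `a 1`, and with it almost every `γ t`, from `C`. -/
theorem IsSpanningCone.tangent {C : Set E} (hC : IsSpanningCone C) {a : ℕ → E} {n : ℕ}
    (hc : ∀ t : ℂ, ∑ i ∈ Finset.range (n + 2), t ^ i • a i ∈ C)
    (hc0 : ∀ t : ℂ, ∑ i ∈ Finset.range (n + 2), t ^ i • a i ≠ 0)
    {F : MvPolynomial (Module.Dual ℂ E) ℂ} {d : ℕ} (hF : F.IsHomogeneous d)
    (hFC : ∀ x ∈ C, polyValue F x = 0) (hFa : polyValue F (a 1) ≠ 0) (h1 : a 1 ≠ 0) :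
    stateBorderRank (projectivized C) (Projectivization.mk ℂ (a 1) h1) = 2 ∧
      Projectivization.mk ℂ (a 1) h1 ∈ secantVariety (projectivized C) 2 := by
  set γ : ℂ → E := fun t => ∑ i ∈ Finset.range (n + 1), t ^ i • a (i + 1) with hγ
  set c : ℂ → E := fun t => ∑ i ∈ Finset.range (n + 2), t ^ i • a i with hcdef
  have hcγ : ∀ t, c t = t • γ t + c 0 := by
    intro t
    have h2 : c 0 = a 0 := by simp [hcdef, Finset.sum_range_succ']
    rw [h2]
    simp only [hcdef, hγ]
    rw [Finset.sum_range_succ', Finset.smul_sum]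
    simp [pow_succ', smul_smul]
  obtain ⟨P, hP⟩ := exists_polynomial_polyValue (fun i => a (i + 1)) (n + 1) F
  have hP0 : P.eval 0 ≠ 0 := by
    rw [hP, Finset.sum_range_succ']
    simpa using hFa
  -- The factor `X` excludes `t = 0`, where `γ` is no longer a secant. The factor `P` excludes the
  -- finitely many `t` at which `F` does not separate `γ t` from `C`.
  have hPX : Polynomial.X * P ≠ 0 := by
    refine mul_ne_zero Polynomial.X_ne_zero ?_
    rintro rfl
    simp at hP0
  have hzero : polyValue F (0 : E) = 0 := hFC 0 (by simpa using hC.smul_mem 0 _ (hc 0))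
  have key : ∀ t, (Polynomial.X * P).eval t ≠ 0 → t ≠ 0 ∧ γ t ≠ 0 ∧ γ t ∉ C := by
    intro t ht
    have hPt : polyValue F (γ t) ≠ 0 := by
      rw [Polynomial.eval_mul, hP] at ht
      exact right_ne_zero_of_mul ht
    exact ⟨fun h => by simp [h] at ht, fun h => hPt (h ▸ hzero), fun h => hPt (hFC _ h)⟩
  have hγeq : ∀ t, t ≠ 0 → γ t = t⁻¹ • c t + (-t⁻¹) • c 0 := by
    intro t ht
    rw [hcγ t, smul_add, smul_smul, inv_mul_cancel₀ ht]
    module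
  refine ⟨?_, mk_mem_zariskiClosure_of_curve (a := fun i => a (i + 1)) (n := n) h1 hPX
    fun t ht => ?_⟩
  · have hmem : Projectivization.mk ℂ (a 1) h1 ∈
        zariskiClosure (rankSubset (projectivized C) 2) := by
      refine mk_mem_zariskiClosure_of_curve (a := fun i => a (i + 1)) (n := n) h1 hPX
        fun t ht => ?_
      obtain ⟨ht0, hne, hnC⟩ := key t ht
      refine ⟨hne, le_antisymm (hC.stateRank_le hne ⟨![t⁻¹ • c t, (-t⁻¹) • c 0], ?_, ?_⟩)
        (hC.le_stateRank hne fun r hr => hr.two_le hne hnC)⟩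
      · intro j
        fin_cases j
        · exact ⟨hC.smul_mem _ _ (hc t), smul_ne_zero (inv_ne_zero ht0) (hc0 t)⟩
        · exact ⟨hC.smul_mem _ _ (hc 0), smul_ne_zero (neg_ne_zero.2 (inv_ne_zero ht0)) (hc0 0)⟩
      · simpa using (hγeq t ht0).symm
    refine le_antisymm (Nat.sInf_le hmem) (le_csInf ⟨2, hmem⟩ fun r hr => ?_)
    by_contra! hlt
    have hr' : Projectivization.mk ℂ (a 1) h1 ∈
      zariskiClosure (rankSubset (projectivized C) r) := hr
    have hsum : ∀ q : ℙ ℂ E, ∃ ψ, ∃ hψ : ψ ≠ 0, q = Projectivization.mk ℂ ψ hψ ∧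
        IsSumOf C (stateRank (projectivized C) q) ψ := by
      intro q
      refine ⟨q.rep, q.rep_nonzero, q.mk_rep.symm, ?_⟩
      have : stateRank (projectivized C) q = sInf {r | IsSumOf C r q.rep} := by
        rw [← hC.stateRank_eq_sInf q.rep_nonzero, q.mk_rep]
      rw [this]
      exact Nat.sInf_mem (s := {r | IsSumOf C r q.rep}) (hC.exists_isSumOf _)
    interval_cases r
    -- No state has rank 0, since an empty sum is the zero vector.
    · have : rankSubset (projectivized C) 0 = ∅ := by
        refine Set.eq_empty_of_forall_notMem fun q hq => ?_
        obtain ⟨ψ, hψ, -, hs⟩ := hsum q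
        rw [show stateRank (projectivized C) q = 0 from hq] at hs
        obtain ⟨x, -, hx⟩ := hs
        exact hψ (by simpa using hx.symm)
      rw [this, zariskiClosure_empty] at hr'
      exact hr'
    -- States of rank 1 lie in `C`, so the closure of `X₁` is contained in the zero set of `F`.
    · refine hFa ((vanishesAt_mk_iff hF h1).1 (hr' d F hF fun q hq => ?_))
      obtain ⟨ψ, hψ, rfl, hs⟩ := hsum q
      rw [show stateRank (projectivized C) (Projectivization.mk ℂ ψ hψ) = 1 from hq] at hs
      exact (vanishesAt_mk_iff hF hψ).2 (hFC _ hs.mem)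
  · obtain ⟨ht0, hne, -⟩ := key t ht
    refine ⟨hne, ![Projectivization.mk ℂ (c t) (hc0 t), Projectivization.mk ℂ (c 0) (hc0 0)],
      fun i => ?_, ?_⟩
    · fin_cases i
      · exact (hC.mk_mem_projectivized _).2 (hc t)
      · exact (hC.mk_mem_projectivized _).2 (hc 0)
    · rw [Projectivization.submodule_mk, Submodule.span_singleton_le_iff_mem]
      change γ t ∈ _
      rw [hγeq t ht0]
      refine add_mem (Submodule.smul_mem _ _ ?_) (Submodule.smul_mem _ _ ?_)
      · refine Submodule.mem_iSup_of_mem 0 ?_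
        simp [Projectivization.submodule_mk, Submodule.mem_span_singleton_self]
      · refine Submodule.mem_iSup_of_mem 1 ?_
        simp [Projectivization.submodule_mk, Submodule.mem_span_singleton_self]

end Cones

/-! ### Curves traced by multilinear maps -/

section Curves

variable {L : ℕ} {H : Fin L → Type*} [∀ j, AddCommGroup (H j)] [∀ j, Module ℂ (H j)]
  {E : Type*} [AddCommGroup E] [Module ℂ E]

/-- The coefficient of `t ^ i` in `M (e + t f)`. -/
def MultilinearMap.curveCoeff (M : MultilinearMap ℂ H E) (e f : ∀ j, H j) (i : ℕ) : E :=
  ∑ S ∈ Finset.powersetCard i Finset.univ, M (S.piecewise f e)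

theorem MultilinearMap.map_add_smul_eq_sum (M : MultilinearMap ℂ H E) (e f : ∀ j, H j) (t : ℂ) :
    M (e + t • f) = ∑ i ∈ Finset.range (L + 1), t ^ i • M.curveCoeff e f i := by
  rw [add_comm, M.map_add_univ, ← Finset.powerset_univ, Finset.sum_powerset, Finset.card_univ,
    Fintype.card_fin]
  refine Finset.sum_congr rfl fun i _ => ?_
  rw [MultilinearMap.curveCoeff, Finset.smul_sum]
  refine Finset.sum_congr rfl fun S hS => ?_
  rw [← (Finset.mem_powersetCard.1 hS).2, ← Finset.prod_const, ← M.map_piecewise_smul]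
  congr 1
  ext j
  by_cases hj : j ∈ S <;> simp [hj]

theorem MultilinearMap.curveCoeff_one (M : MultilinearMap ℂ H E) (e f : ∀ j, H j) :
    M.curveCoeff e f 1 = ∑ k, M (Function.update e k (f k)) := by
  rw [MultilinearMap.curveCoeff, Finset.powersetCard_one, Finset.sum_map]
  exact Finset.sum_congr rfl fun k _ => by simp [Finset.piecewise_singleton]

/-- By the Leibniz rule, `ψ` is the velocity at `t = 0` of the curve `M (e + t • f)`. -/
theorem IsSpanningCone.multilinear_tangent {C : Set E} (hC : IsSpanningCone C) (hL : 1 ≤ L)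
    (M : MultilinearMap ℂ H E) (e f : ∀ j, H j) (hM : ∀ t : ℂ, M (e + t • f) ∈ C)
    (hM0 : ∀ t : ℂ, M (e + t • f) ≠ 0)
    {F : MvPolynomial (Module.Dual ℂ E) ℂ} {d : ℕ} (hF : F.IsHomogeneous d)
    (hFC : ∀ x ∈ C, polyValue F x = 0) {ψ : E} (hψ : ψ = ∑ k, M (Function.update e k (f k)))
    (hFψ : polyValue F ψ ≠ 0) (h1 : ψ ≠ 0) :
    stateBorderRank (projectivized C) (Projectivization.mk ℂ ψ h1) = 2 ∧
      Projectivization.mk ℂ ψ h1 ∈ secantVariety (projectivized C) 2 := by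
  -- The curve has `L + 1 = n + 2` coefficients, so the linear one is present.
  obtain ⟨n, rfl⟩ : ∃ n, L = n + 1 := ⟨L - 1, by omega⟩
  rw [← M.curveCoeff_one] at hψ
  subst hψ
  exact hC.tangent (n := n) (fun t => M.map_add_smul_eq_sum e f t ▸ hM t)
    (fun t => M.map_add_smul_eq_sum e f t ▸ hM0 t) hF hFC hFψ h1

end Curves

/-! ### Rank at least 3 from Plücker type relations -/

section WCoordinates

variable {E : Type*} [AddCommGroup E] [Module ℂ E]

/-- Linear coordinates which satisfy quadratic relations of Plücker type on `C` and in which `ψ`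
looks like a W state of three modes. -/
structure WCoordinates (C : Set E) (ψ : E) where
  /-- The coordinate without excitations. -/
  s : Module.Dual ℂ E
  /-- The coordinates with a single excitation. -/
  m : Fin 3 → Fin 3 → Module.Dual ℂ E
  /-- The coordinates with two excitations. -/
  b : Fin 3 → Fin 3 → Fin 3 → Fin 3 → Module.Dual ℂ E
  /-- The coordinate with three excitations. -/
  q : Module.Dual ℂ E
  minor : ∀ x ∈ C, ∀ i k j l, i ≠ k → m i j x * m k l x - m i l x * m k j x = s x * b i k j l x
  minor' : ∀ x ∈ C, b 0 1 0 1 x * b 0 2 0 2 x - b 0 1 0 2 x * b 0 2 0 1 x = m 0 0 x * q x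
  s_apply : s ψ = 0
  m_self : ∀ i, m i i ψ = 1
  m_ne : ∀ i j, i ≠ j → m i j ψ = 0
  b_apply : ∀ i k j l, i ≠ k → b i k j l ψ = 0
  q_apply : q ψ = 0

namespace WCoordinates

variable {C : Set E} {ψ : E}

theorem ne_zero (w : WCoordinates C ψ) : ψ ≠ 0 := by
  intro h
  simpa [h] using w.m_self 0

theorem notMem (w : WCoordinates C ψ) : ψ ∉ C := by
  intro h
  simpa [w.m_self, w.m_ne, w.s_apply] using w.minor ψ h 0 1 0 1 (by decide)

/-- If `ψ = y + z`, each coordinate of `z` is minus that of `y`, except that `m i i` becomes `1 - m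
i i`. Products of two sign-changing coordinates agree at `y` and `z`, so comparing the same relation
at both points leaves equations that determine the coordinates of `y` up to a contradiction. -/
theorem three_le (w : WCoordinates C ψ) {r : ℕ} (h : IsSumOf C r ψ) : 3 ≤ r := by
  have h2 := h.two_le w.ne_zero w.notMem
  by_contra! h3
  obtain rfl : r = 2 := by omega
  obtain ⟨x, hx, hψ⟩ := h
  rw [Fin.sum_univ_two] at hψ
  have hx0 := (hx 0).1
  have hx1 := (hx 1).1
  generalize x 0 = y at *
  generalize x 1 = z at *
  have hadd : ∀ g : Module.Dual ℂ E, g y + g z = g ψ := fun g => by rw [← map_add, hψ]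
  have hs : w.s z = -w.s y := by
    linear_combination hadd _ + w.s_apply
  have hd : ∀ i, w.m i i z = 1 - w.m i i y := fun i => by
    linear_combination hadd _ + w.m_self i
  have hm : ∀ i j, i ≠ j → w.m i j z = -w.m i j y := fun i j hij => by
    linear_combination hadd _ + w.m_ne i j hij
  have hb : ∀ i k j l, i ≠ k → w.b i k j l z = -w.b i k j l y := fun i k j l hik => by
    linear_combination hadd _ + w.b_apply i k j l hik
  have hq : w.q z = -w.q y := by
    linear_combination hadd _ + w.q_apply
  -- In the `(i, k; i, l)` minor only the term `m i i * m k l` differs between `y` and `z`, and the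
  -- difference of the two relations is `m k l`.
  have hoff : ∀ i k l, i ≠ k → i ≠ l → k ≠ l → w.m k l y = 0 := by
    intro i k l hik hil hkl
    have h1 := w.minor y hx0 i k i l hik
    have h2 := w.minor z hx1 i k i l hik
    rw [hd, hm k l hkl, hm i l hil, hm k i hik.symm, hs, hb _ _ _ _ hik] at h2
    linear_combination h1 - h2
  -- Here the difference is `m i i + m k k - 1`. The three such equations force every diagonal entry
  -- to be `1/2`.
  have hsum : ∀ i k, i ≠ k → w.m i i y + w.m k k y = 1 := by
    intro i k hik
    have h1 := w.minor y hx0 i k i k hik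
    have h2 := w.minor z hx1 i k i k hik
    rw [hd, hd, hm i k hik, hm k i hik.symm, hs, hb _ _ _ _ hik] at h2
    linear_combination h1 - h2
  have h01 := hsum 0 1 (by decide)
  have h02 := hsum 0 2 (by decide)
  have h12 := hsum 1 2 (by decide)
  have e0 : w.m 0 0 y = 1 / 2 := by linear_combination (h01 + h02 - h12) / 2
  have e1 : w.m 1 1 y = 1 / 2 := by linear_combination (h01 - h02 + h12) / 2
  have e2 : w.m 2 2 y = 1 / 2 := by linear_combination (h02 - h01 + h12) / 2
  have b01 := w.minor y hx0 0 1 0 1 (by decide)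
  have b02 := w.minor y hx0 0 2 0 2 (by decide)
  have b3 := w.minor y hx0 0 1 0 2 (by decide)
  rw [e0, e1, hoff 2 0 1 (by decide) (by decide) (by decide)] at b01
  rw [e0, e2, hoff 1 0 2 (by decide) (by decide) (by decide)] at b02
  rw [hoff 0 1 2 (by decide) (by decide) (by decide),
    hoff 1 0 2 (by decide) (by decide) (by decide)] at b3
  have hs0 : w.s y ≠ 0 := by
    intro h
    rw [h] at b01
    norm_num at b01
  have hA : w.b 0 1 0 2 y = 0 := by
    have : w.s y * w.b 0 1 0 2 y = 0 := by linear_combination -b3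
    exact (mul_eq_zero.1 this).resolve_left hs0
  have q1 := w.minor' y hx0
  have q2 := w.minor' z hx1
  rw [hd, hq, hb _ _ _ _ (by decide), hb _ _ _ _ (by decide), hb _ _ _ _ (by decide),
    hb _ _ _ _ (by decide), hA, e0] at q2
  rw [hA, e0] at q1
  -- The right side of `minor'` is `q y / 2` at `y` and `-q y / 2` at `z`, while the left side is
  -- the same product. That product is therefore zero, although `s y ^ 2` times it equals `1/16`.
  have hbb : w.b 0 1 0 1 y * w.b 0 2 0 2 y = 0 := by linear_combination (q1 + q2) / 2
  have : (1 / 4 : ℂ) * (1 / 4) = w.s y * w.s y * (w.b 0 1 0 1 y * w.b 0 2 0 2 y) := by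
    linear_combination (1 / 4) * b01 + w.s y * w.b 0 1 0 1 y * b02
  rw [hbb] at this
  norm_num at this

/-- The quadric which vanishes on `C` but not at `ψ`. -/
theorem exists_quadric (w : WCoordinates C ψ) :
    ∃ F : MvPolynomial (Module.Dual ℂ E) ℂ, F.IsHomogeneous 2 ∧
      (∀ x ∈ C, polyValue F x = 0) ∧ polyValue F ψ ≠ 0 := by
  have hX := fun f : Module.Dual ℂ E => MvPolynomial.isHomogeneous_X ℂ f
  refine ⟨MvPolynomial.X (w.m 0 0) * MvPolynomial.X (w.m 1 1) -
    MvPolynomial.X (w.m 0 1) * MvPolynomial.X (w.m 1 0) -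
    MvPolynomial.X w.s * MvPolynomial.X (w.b 0 1 0 1),
    (((hX _).mul (hX _)).sub ((hX _).mul (hX _))).sub ((hX _).mul (hX _)), fun x hx => ?_, ?_⟩
  · simp [polyValue, w.minor x hx 0 1 0 1 (by decide)]
  · simp [polyValue, w.m_self, w.m_ne, w.s_apply]

theorem three_le_stateRank (w : WCoordinates C ψ) (hC : IsSpanningCone C) :
    3 ≤ stateRank (projectivized C) (Projectivization.mk ℂ ψ w.ne_zero) :=
  hC.le_stateRank _ fun _ hr => w.three_le hr

variable {L : ℕ} {H : Fin L → Type*} [∀ j, AddCommGroup (H j)] [∀ j, Module ℂ (H j)]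

theorem tangent (w : WCoordinates C ψ) (hC : IsSpanningCone C) (hL : 1 ≤ L)
    (M : MultilinearMap ℂ H E) (e f : ∀ j, H j) (hM : ∀ t : ℂ, M (e + t • f) ∈ C)
    (hM0 : ∀ t : ℂ, M (e + t • f) ≠ 0) (hψ : ψ = ∑ k, M (Function.update e k (f k))) :
    stateBorderRank (projectivized C) (Projectivization.mk ℂ ψ w.ne_zero) = 2 ∧
      Projectivization.mk ℂ ψ w.ne_zero ∈ secantVariety (projectivized C) 2 := by
  obtain ⟨F, hF, hFC, hFψ⟩ := w.exists_quadric
  exact hC.multilinear_tangent hL M e f hM hM0 hF hFC hψ hFψ _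

theorem exceptional (w : WCoordinates C ψ) (hC : IsSpanningCone C) (hL : 1 ≤ L)
    (M : MultilinearMap ℂ H E) (e f : ∀ j, H j) (hM : ∀ t : ℂ, M (e + t • f) ∈ C)
    (hM0 : ∀ t : ℂ, M (e + t • f) ≠ 0) (hψ : ψ = ∑ k, M (Function.update e k (f k))) :
    ∃ p, IsExceptional (projectivized C) p ∧
      stateBorderRank (projectivized C) p < stateRank (projectivized C) p ∧
      p ∈ secantVariety (projectivized C) 2 := by
  have h := w.tangent hC hL M e f hM hM0 hψ
  have h3 := w.three_le_stateRank hC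
  refine ⟨_, ?_, ?_, h.2⟩
  · unfold IsExceptional
    omega
  · omega

end WCoordinates

end WCoordinates

/-! ### Distinguishable particles: the Segre variety -/

section Segre

variable {L : ℕ} {H : Fin L → Type*} [∀ j, AddCommGroup (H j)] [∀ j, Module ℂ (H j)]

/-- The product vectors. -/
def productVectors (H : Fin L → Type*) [∀ j, AddCommGroup (H j)] [∀ j, Module ℂ (H j)] :
    Set (⨂[ℂ] j, H j) :=
  Set.range (PiTensorProduct.tprod ℂ)

theorem segreVariety_eq : segreVariety H = projectivized (productVectors H) := by
  ext p
  constructor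
  · rintro ⟨v, h, rfl⟩
    exact ⟨_, h, ⟨v, rfl⟩, rfl⟩
  · rintro ⟨_, h, ⟨v, rfl⟩, rfl⟩
    exact ⟨v, h, rfl⟩

theorem isSpanningCone_productVectors (hL : 1 ≤ L) : IsSpanningCone (productVectors H) where
  smul_mem := by
    rintro a _ ⟨v, rfl⟩
    exact ⟨Function.update v ⟨0, hL⟩ (a • v ⟨0, hL⟩), by simp [MultilinearMap.map_update_smul]⟩
  span_eq_top := PiTensorProduct.span_tprod_eq_top

/-- The tensor product of the functionals `χ j`, `j ∈ S`, and `φ j`, `j ∉ S`. -/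
def productFunctional (φ χ : ∀ j, Module.Dual ℂ (H j)) (S : Finset (Fin L)) :
    Module.Dual ℂ (⨂[ℂ] j, H j) :=
  PiTensorProduct.lift ((MultilinearMap.mkPiAlgebra ℂ (Fin L) ℂ).compLinearMap (S.piecewise χ φ))

theorem productFunctional_tprod (φ χ : ∀ j, Module.Dual ℂ (H j)) (S : Finset (Fin L))
    (v : ∀ j, H j) : productFunctional φ χ S (PiTensorProduct.tprod ℂ v) =
      ∏ j, if j ∈ S then χ j (v j) else φ j (v j) := by
  simp only [productFunctional, PiTensorProduct.lift.tprod, MultilinearMap.compLinearMap_apply,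
    MultilinearMap.mkPiAlgebra_apply]
  exact Finset.prod_congr rfl fun j _ => by by_cases h : j ∈ S <;> simp [h]

/-- Both sides are products over the modes, and each mode `j` lies in as many of `S`, `T` as of `S ∩
T`, `S ∪ T`. The factors at `j` therefore agree up to order. -/
theorem productFunctional_mul (φ χ : ∀ j, Module.Dual ℂ (H j)) {S T U V : Finset (Fin L)}
    (hu : S ∪ T = U) (hi : S ∩ T = V) {x : ⨂[ℂ] j, H j} (hx : x ∈ productVectors H) :
    productFunctional φ χ S x * productFunctional φ χ T x =
      productFunctional φ χ V x * productFunctional φ χ U x := by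
  obtain ⟨v, rfl⟩ := hx
  subst hu hi
  simp only [productFunctional_tprod, ← Finset.prod_mul_distrib]
  refine Finset.prod_congr rfl fun j _ => ?_
  by_cases h1 : j ∈ S <;> by_cases h2 : j ∈ T <;> simp [h1, h2, mul_comm]

variable {φ χ : ∀ j, Module.Dual ℂ (H j)} {e f : ∀ j, H j}

theorem productFunctional_add_smul (hφe : ∀ j, φ j (e j) = 1) (hφf : ∀ j, φ j (f j) = 0) (t : ℂ) :
    productFunctional φ χ ∅ (PiTensorProduct.tprod ℂ (e + t • f)) = 1 := by
  simp [productFunctional_tprod, hφe, hφf]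

theorem productFunctional_singleton_update (hφe : ∀ j, φ j (e j) = 1) (hχf : ∀ j, χ j (f j) = 1)
    (k : Fin L) :
    productFunctional φ χ {k} (PiTensorProduct.tprod ℂ (Function.update e k (f k))) = 1 := by
  rw [productFunctional_tprod]
  refine Finset.prod_eq_one fun j _ => ?_
  by_cases h : j = k
  · subst h; simp [hχf]
  · simp [h, hφe]

theorem productFunctional_update (hχe : ∀ j, χ j (e j) = 0) (hφf : ∀ j, φ j (f j) = 0)
    {S : Finset (Fin L)} {k : Fin L} (h : S ≠ {k}) :
    productFunctional φ χ S (PiTensorProduct.tprod ℂ (Function.update e k (f k))) = 0 := by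
  rw [productFunctional_tprod]
  by_cases hk : k ∈ S
  · obtain ⟨j, hj, hjk⟩ : ∃ j ∈ S, j ≠ k := by
      by_contra! hc
      exact h (Finset.eq_singleton_iff_unique_mem.2 ⟨hk, hc⟩)
    exact Finset.prod_eq_zero (Finset.mem_univ j) (by simp [hj, hjk, hχe])
  · exact Finset.prod_eq_zero (Finset.mem_univ k) (by simp [hk, hφf])

theorem productFunctional_sum_update (hφe : ∀ j, φ j (e j) = 1) (hφf : ∀ j, φ j (f j) = 0)
    (hχe : ∀ j, χ j (e j) = 0) (hχf : ∀ j, χ j (f j) = 1) (S : Finset (Fin L)) :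
    productFunctional φ χ S (∑ k, PiTensorProduct.tprod ℂ (Function.update e k (f k))) =
      if S.card = 1 then 1 else 0 := by
  rw [map_sum]
  split_ifs with h
  · obtain ⟨k, rfl⟩ := Finset.card_eq_one.1 h
    rw [Finset.sum_eq_single k, productFunctional_singleton_update hφe hχf]
    · exact fun j _ hj => productFunctional_update hχe hφf (by simpa using hj.symm)
    · simp
  · refine Finset.sum_eq_zero fun k _ => productFunctional_update hχe hφf ?_
    rintro rfl
    simp at h

/-- The coordinates of the W state of `L ≥ 3` distinguishable particles. -/
def segreWCoordinates (hL : 3 ≤ L) (hφe : ∀ j, φ j (e j) = 1) (hφf : ∀ j, φ j (f j) = 0)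
    (hχe : ∀ j, χ j (e j) = 0) (hχf : ∀ j, χ j (f j) = 1) :
    WCoordinates (productVectors H)
      (∑ k, PiTensorProduct.tprod ℂ (Function.update e k (f k))) where
  s := productFunctional φ χ ∅
  -- Each mode has only its own excitation `χ`, so the matrix `m` is diagonal. Its `2 × 2` minors
  -- vanish unless `{j, l} = {i, k}`, and `b` carries the sign of the matching.
  m i j := if i = j then productFunctional φ χ {Fin.castLE hL i} else 0
  b i k j l :=
    if i = j ∧ k = l then productFunctional φ χ {Fin.castLE hL i, Fin.castLE hL k}
    else if i = l ∧ k = j then -productFunctional φ χ {Fin.castLE hL i, Fin.castLE hL k}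
    else 0
  q := productFunctional φ χ {Fin.castLE hL 0, Fin.castLE hL 1, Fin.castLE hL 2}
  minor x hx i k j l hik := by
    have key := productFunctional_mul φ χ (S := {Fin.castLE hL i}) (T := {Fin.castLE hL k})
      rfl (Finset.singleton_inter_of_notMem (by simpa using hik)) hx
    rw [← Finset.insert_eq] at key
    by_cases hij : i = j
    · subst hij
      by_cases hkl : k = l
      · subst hkl
        simp [hik, key]
      · simp [hkl, hik.symm]
    · by_cases hkj : k = j
      · subst hkj
        by_cases hil : i = l
        · subst hil
          simp [hik, key]
        · simp [hil, hik]
      · simp [hij, hkj]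
  minor' x hx := by
    simpa using productFunctional_mul φ χ (S := {Fin.castLE hL 0, Fin.castLE hL 1})
      (T := {Fin.castLE hL 0, Fin.castLE hL 2})
      (U := {Fin.castLE hL 0, Fin.castLE hL 1, Fin.castLE hL 2}) (V := {Fin.castLE hL 0})
      (by ext; simp)
      (by ext a; simp only [Finset.mem_inter, Finset.mem_insert, Finset.mem_singleton, Fin.ext_iff,
            Fin.val_castLE, Fin.val_zero, Fin.val_one, Fin.val_two]; omega) hx
  s_apply := by simp [productFunctional_sum_update hφe hφf hχe hχf]
  m_self i := by simp [productFunctional_sum_update hφe hφf hχe hχf]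
  m_ne i j hij := by simp [hij]
  b_apply i k j l hik := by
    have : ({Fin.castLE hL i, Fin.castLE hL k} : Finset (Fin L)).card = 2 :=
      Finset.card_pair (by simpa using hik)
    have h0 := productFunctional_sum_update hφe hφf hχe hχf {Fin.castLE hL i, Fin.castLE hL k}
    rw [this, if_neg (by norm_num)] at h0
    split_ifs <;> simp only [h0, LinearMap.neg_apply, neg_zero, LinearMap.zero_apply]
  q_apply := by
    have : ({Fin.castLE hL 0, Fin.castLE hL 1, Fin.castLE hL 2} : Finset (Fin L)).card = 3 :=
      Finset.card_eq_three.2 ⟨_, _, _, by simp, by simp, by simp, rfl⟩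
    simp [productFunctional_sum_update hφe hφf hχe hχf, this]

theorem LinearIndependent.exists_dual {ι V : Type*} [AddCommGroup V] [Module ℂ V] {v : ι → V}
    (h : LinearIndependent ℂ v) :
    ∃ φ : ι → Module.Dual ℂ V, ∀ i, φ i (v i) = 1 ∧ ∀ j, i ≠ j → φ i (v j) = 0 := by
  obtain ⟨g, hg⟩ := LinearMap.exists_leftInverse_of_injective _ (LinearMap.ker_eq_bot.2 h)
  have hv : ∀ j, g (v j) = Finsupp.single j 1 := fun j => by
    simpa using LinearMap.congr_fun hg (Finsupp.single j 1)
  exact ⟨fun i => Finsupp.lapply i ∘ₗ g, fun i => ⟨by simp [hv], fun j hij => by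
    simp [hv, Finsupp.single_eq_of_ne hij]⟩⟩

theorem exists_dual_pair {V : Type*} [AddCommGroup V] [Module ℂ V] {u w : V}
    (h : LinearIndependent ℂ ![u, w]) : ∃ φ χ : Module.Dual ℂ V,
      φ u = 1 ∧ φ w = 0 ∧ χ u = 0 ∧ χ w = 1 := by
  obtain ⟨φ, hφ⟩ := h.exists_dual
  exact ⟨φ 0, φ 1, by simpa using (hφ 0).1, by simpa using (hφ 0).2 1, by simpa using (hφ 1).2 0,
    by simpa using (hφ 1).1⟩

theorem exists_linearIndependent_pair_of_finrank {V : Type*} [AddCommGroup V] [Module ℂ V]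
    (h : 2 ≤ Module.finrank ℂ V) : ∃ u w : V, LinearIndependent ℂ ![u, w] := by
  obtain ⟨v, hv⟩ := exists_linearIndependent_of_le_finrank h
  exact ⟨v 0, v 1, by convert hv using 1; ext i; fin_cases i <;> rfl⟩

theorem segre_exceptional (hL : 3 ≤ L)
    (hH : ∀ j, 2 ≤ Module.finrank ℂ (H j)) :
    ∃ p : ℙ ℂ (⨂[ℂ] j, H j), IsExceptional (segreVariety H) p ∧
      stateBorderRank (segreVariety H) p < stateRank (segreVariety H) p ∧
      p ∈ secantVariety (segreVariety H) 2 := by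
  choose e f hef using fun j => exists_linearIndependent_pair_of_finrank (hH j)
  choose φ χ hφe hφf hχe hχf using fun j => exists_dual_pair (hef j)
  rw [segreVariety_eq]
  refine (segreWCoordinates hL hφe hφf hχe hχf).exceptional
    (isSpanningCone_productVectors (by omega)) (by omega) (PiTensorProduct.tprod ℂ) e f
    (fun t => ⟨_, rfl⟩) (fun t h => ?_) rfl
  -- The product of the `φ j` is `1` along the whole curve, so the curve never meets zero.
  have := productFunctional_add_smul (χ := χ) hφe hφf t
  simp [h] at this

theorem segre_wState {H : Fin 3 → Type*} [∀ j, AddCommGroup (H j)] [∀ j, Module ℂ (H j)]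
    (e f : ∀ j, H j) (hef : ∀ j, LinearIndependent ℂ ![e j, f j]) :
    ∃ h : wState e f ≠ 0,
      stateRank (segreVariety H) (Projectivization.mk ℂ (wState e f) h) = 3 ∧
      stateBorderRank (segreVariety H) (Projectivization.mk ℂ (wState e f) h) = 2 := by
  choose φ χ hφe hφf hχe hχf using fun j => exists_dual_pair (hef j)
  have w := segreWCoordinates le_rfl hφe hφf hχe hχf
  have hC := isSpanningCone_productVectors (H := H) (by omega)
  rw [segreVariety_eq]
  refine ⟨w.ne_zero, le_antisymm (hC.stateRank_le _ ⟨_, fun k => ⟨⟨_, rfl⟩, fun h => ?_⟩, rfl⟩)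
    (w.three_le_stateRank hC), (w.tangent hC (by omega) (PiTensorProduct.tprod ℂ) e f
    (fun t => ⟨_, rfl⟩) (fun t h => ?_) rfl).1⟩
  · have := productFunctional_singleton_update hφe hχf k
    simp [h] at this
  · have := productFunctional_add_smul (χ := χ) hφe hφf t
    simp [h] at this

end Segre

/-! ### A determinantal Plücker relation -/

section Pluecker

open Matrix

variable {n R : Type*} [Fintype n] [DecidableEq n] [CommRing R]

/-- The three-term Plücker relation between minors of a matrix extended by two columns. -/
theorem Matrix.det_updateCol_mul_det_updateCol_sub (A : Matrix n n R) {i k : n} (hik : i ≠ k)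
    (x y : n → R) :
    (A.updateCol i x).det * (A.updateCol k y).det - (A.updateCol i y).det * (A.updateCol k x).det =
      A.det * ((A.updateCol i x).updateCol k y).det := by
  set B := A.updateCol i x with hB
  -- Cramer's rule gives `B *ᵥ c = B.det • y` without division. Splitting off column `i` of `B`,
  -- applying the adjugate of `A` and reading off entry `k` yields the relation over any commutative
  -- ring.
  set c := B.cramer y with hc
  have hci : c i = (A.updateCol i y).det := by
    rw [hc, cramer_apply, hB, updateCol_idem]
  have hck : c k = (B.updateCol k y).det := by rw [hc, cramer_apply]
  have h1 : B *ᵥ c = A *ᵥ (c - Pi.single i (c i)) + c i • x := by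
    ext m
    simp only [mulVec, dotProduct, Pi.add_apply, Pi.smul_apply, Pi.sub_apply, smul_eq_mul]
    rw [← Finset.add_sum_erase _ _ (Finset.mem_univ i),
      ← Finset.add_sum_erase _ _ (Finset.mem_univ i)]
    simp only [hB, updateCol_self, Pi.single_eq_same, sub_self, mul_zero, zero_add]
    rw [add_comm, mul_comm (x m)]
    congr 1
    refine Finset.sum_congr rfl fun j hj => ?_
    have hj' := Finset.ne_of_mem_erase hj
    rw [updateCol_ne hj', Pi.single_eq_of_ne hj', sub_zero]
  have h2 : B *ᵥ c = B.det • y := B.mulVec_cramer y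
  have h3 := congrFun (congrArg (fun v => A.adjugate *ᵥ v) (h1.symm.trans h2)) k
  simp only [mulVec_add, mulVec_mulVec, adjugate_mul, mulVec_smul, ← cramer_eq_adjugate_mulVec,
    Pi.add_apply, Pi.smul_apply, smul_eq_mul, smul_mulVec, one_mulVec, Pi.sub_apply,
    Pi.single_eq_of_ne hik.symm, sub_zero, cramer_apply] at h3
  rw [← hck, ← hci]
  linear_combination -h3

end Pluecker

/-! ### Fermions: the Grassmann variety -/

section Grassmann

variable {L : ℕ} {V : Type*} [AddCommGroup V] [Module ℂ V]

/-- The decomposable vectors. -/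
def decomposableVectors (L : ℕ) (V : Type*) [AddCommGroup V] [Module ℂ V] : Set (⋀[ℂ]^L V) :=
  Set.range (exteriorPower.ιMulti ℂ L)

theorem grassmannVariety_eq : grassmannVariety L V = projectivized (decomposableVectors L V) := by
  ext p
  constructor
  · rintro ⟨v, -, h, rfl⟩
    exact ⟨_, h, ⟨v, rfl⟩, rfl⟩
  · rintro ⟨_, h, ⟨v, rfl⟩, rfl⟩
    refine ⟨v, ?_, h, rfl⟩
    -- Linear independence is automatic, because the wedge of a dependent family is zero.
    by_contra hv
    exact h (AlternatingMap.map_linearDependent _ v hv)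

theorem isSpanningCone_decomposableVectors (hL : 1 ≤ L) :
    IsSpanningCone (decomposableVectors L V) where
  smul_mem := by
    rintro a _ ⟨v, rfl⟩
    exact ⟨Function.update v ⟨0, hL⟩ (a • v ⟨0, hL⟩), by simp [AlternatingMap.map_update_smul]⟩
  span_eq_top := exteriorPower.ιMulti_span ℂ L V

/-- The functional on the exterior power given by the determinant of a family of functionals. -/
noncomputable def minorFunctional (x : Fin L → Module.Dual ℂ V) : Module.Dual ℂ (⋀[ℂ]^L V) :=
  exteriorPower.alternatingMapLinearEquiv
    (Matrix.detRowAlternating.compLinearMap (LinearMap.pi x))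

theorem minorFunctional_ιMulti (x : Fin L → Module.Dual ℂ V) (u : Fin L → V) :
    minorFunctional x (exteriorPower.ιMulti ℂ L u) = (Matrix.of fun j i => x i (u j)).det := by
  rw [minorFunctional, exteriorPower.alternatingMapLinearEquiv_apply_ιMulti]
  rfl

theorem minorFunctional_pluecker (x : Fin L → Module.Dual ℂ V) {i k : Fin L} (hik : i ≠ k)
    (y z : Module.Dual ℂ V) {ω : ⋀[ℂ]^L V} (hω : ω ∈ decomposableVectors L V) :
    minorFunctional (Function.update x i y) ω * minorFunctional (Function.update x k z) ω -
      minorFunctional (Function.update x i z) ω * minorFunctional (Function.update x k y) ω =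
    minorFunctional x ω *
      minorFunctional (Function.update (Function.update x i y) k z) ω := by
  obtain ⟨u, rfl⟩ := hω
  have key : ∀ (x : Fin L → Module.Dual ℂ V) (i : Fin L) (y : Module.Dual ℂ V),
      (Matrix.of fun j m => Function.update x i y m (u j)) =
        (Matrix.of fun j m => x m (u j)).updateCol i fun j => y (u j) := by
    intro x i y
    ext j m
    by_cases h : m = i
    · subst h; simp
    · simp [h]
  simp only [minorFunctional_ιMulti, key]
  exact Matrix.det_updateCol_mul_det_updateCol_sub _ hik _ _

theorem minorFunctional_ιMulti_eq_zero {x : Fin L → Module.Dual ℂ V} {u : Fin L → V} (j : Fin L)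
    (h : ∀ i, x i (u j) = 0) : minorFunctional x (exteriorPower.ιMulti ℂ L u) = 0 := by
  rw [minorFunctional_ιMulti]
  exact Matrix.det_eq_zero_of_row_eq_zero j h

theorem minorFunctional_ιMulti_eq_one {x : Fin L → Module.Dual ℂ V} {u : Fin L → V}
    (h : ∀ i, x i (u i) = 1) (h' : ∀ i j, i ≠ j → x i (u j) = 0) :
    minorFunctional x (exteriorPower.ιMulti ℂ L u) = 1 := by
  rw [minorFunctional_ιMulti, ← Matrix.det_one (n := Fin L)]
  congr 1
  ext j i
  by_cases hij : i = j
  · subst hij; simp [h]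
  · simp [h' i j hij, Matrix.one_apply_ne' hij]

/-- A partial dual basis adapted to the W state of `L ≥ 3` fermions. -/
structure FermionicDual (hL : 3 ≤ L) (e f : Fin L → V) (φ : Fin L → Module.Dual ℂ V)
    (χ : Fin 3 → Module.Dual ℂ V) : Prop where
  φ_self : ∀ i, φ i (e i) = 1
  φ_ne : ∀ i j, i ≠ j → φ i (e j) = 0
  φ_f : ∀ i j, φ i (f j) = 0
  χ_e : ∀ i j, χ i (e j) = 0
  χ_self : ∀ i, χ i (f (Fin.castLE hL i)) = 1
  χ_ne : ∀ i j, i ≠ j → χ i (f (Fin.castLE hL j)) = 0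

namespace FermionicDual

variable {hL : 3 ≤ L} {e f : Fin L → V} {φ : Fin L → Module.Dual ℂ V}
  {χ : Fin 3 → Module.Dual ℂ V}

theorem apply_add_smul (d : FermionicDual hL e f φ χ) (t : ℂ) :
    minorFunctional φ (exteriorPower.ιMulti ℂ L (e + t • f)) = 1 :=
  minorFunctional_ιMulti_eq_one (by simp [d.φ_self, d.φ_f])
    (fun i j hij => by simp [d.φ_ne i j hij, d.φ_f])

/-- The vector `e m` is still present, while `φ m`, the only one of the functionals not vanishing on
it, has been replaced in slot `m`. The row of `e m` in the determinant is therefore zero. -/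
theorem apply_update (d : FermionicDual hL e f φ χ) {x : Fin L → Module.Dual ℂ V} {k m : Fin L}
    (hm : m ≠ k) (hx : ∀ i, (i ≠ m ∧ x i = φ i) ∨ ∃ j, x i = χ j) :
    minorFunctional x (exteriorPower.ιMulti ℂ L (Function.update e k (f k))) = 0 := by
  refine minorFunctional_ιMulti_eq_zero m fun i => ?_
  rw [Function.update_of_ne hm]
  rcases hx i with ⟨h1, h2⟩ | ⟨j, h⟩
  · rw [h2, d.φ_ne i m h1]
  · rw [h, d.χ_e]

theorem apply_update_self (d : FermionicDual hL e f φ χ) (k : Fin 3) :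
    minorFunctional (Function.update φ (Fin.castLE hL k) (χ k)) (exteriorPower.ιMulti ℂ L
      (Function.update e (Fin.castLE hL k) (f (Fin.castLE hL k)))) = 1 := by
  refine minorFunctional_ιMulti_eq_one (fun i => ?_) fun i j hij => ?_
  · by_cases h : i = Fin.castLE hL k
    · subst h; simp [d.χ_self]
    · simp [h, d.φ_self]
  · by_cases h : i = Fin.castLE hL k
    · subst h
      simp [hij.symm, d.χ_e]
    · by_cases h' : j = Fin.castLE hL k
      · subst h'
        simp [h, d.φ_f]
      · simp [h, h', d.φ_ne i j hij]

/-- The coordinates of the W state of `L ≥ 3` fermions. -/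
noncomputable def wCoordinates (d : FermionicDual hL e f φ χ) :
    WCoordinates (decomposableVectors L V)
      (∑ k, exteriorPower.ιMulti ℂ L (Function.update e k (f k))) where
  s := minorFunctional φ
  m i j := minorFunctional (Function.update φ (Fin.castLE hL i) (χ j))
  b i k j l := minorFunctional
    (Function.update (Function.update φ (Fin.castLE hL i) (χ j)) (Fin.castLE hL k) (χ l))
  q := minorFunctional (Function.update (Function.update (Function.update φ
    (Fin.castLE hL 0) (χ 0)) (Fin.castLE hL 1) (χ 1)) (Fin.castLE hL 2) (χ 2))
  minor ω hω i k j l hik := minorFunctional_pluecker φ (by simpa using hik) _ _ hω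
  -- The same Plücker relation, based at the family in which slot `0` is already excited.
  minor' ω hω := minorFunctional_pluecker (Function.update φ (Fin.castLE hL 0) (χ 0))
    (by simp) _ _ hω
  s_apply := by
    rw [map_sum]
    refine Finset.sum_eq_zero fun k _ => minorFunctional_ιMulti_eq_zero k fun i => ?_
    simp [d.φ_f]
  m_self i := by
    rw [map_sum, Finset.sum_eq_single (Fin.castLE hL i), d.apply_update_self]
    · intro k _ hk
      refine d.apply_update hk.symm fun n => ?_
      by_cases h : n = Fin.castLE hL i
      · exact Or.inr ⟨i, by simp [h]⟩
      · exact Or.inl ⟨h, by simp [h]⟩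
    · simp
  m_ne i j hij := by
    rw [map_sum]
    refine Finset.sum_eq_zero fun k _ => ?_
    by_cases hk : Fin.castLE hL i = k
    · subst hk
      refine minorFunctional_ιMulti_eq_zero (Fin.castLE hL i) fun n => ?_
      by_cases h : n = Fin.castLE hL i
      · subst h
        simp [d.χ_ne j i hij.symm]
      · simp [h, d.φ_f]
    · refine d.apply_update hk fun n => ?_
      by_cases h : n = Fin.castLE hL i
      · exact Or.inr ⟨j, by simp [h]⟩
      · exact Or.inl ⟨h, by simp [h]⟩
  b_apply i k j l hik := by
    rw [map_sum]
    refine Finset.sum_eq_zero fun k' _ => ?_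
    have hx : ∀ n, (n ≠ Fin.castLE hL i ∧ n ≠ Fin.castLE hL k ∧ Function.update (Function.update φ
        (Fin.castLE hL i) (χ j)) (Fin.castLE hL k) (χ l) n = φ n) ∨ ∃ j', Function.update
        (Function.update φ (Fin.castLE hL i) (χ j)) (Fin.castLE hL k) (χ l) n = χ j' := by
      intro n
      by_cases h1 : n = Fin.castLE hL k
      · exact Or.inr ⟨l, by simp [h1]⟩
      · by_cases h2 : n = Fin.castLE hL i
        · exact Or.inr ⟨j, by rw [Function.update_of_ne h1, h2, Function.update_self]⟩
        · exact Or.inl ⟨h2, h1, by simp [h1, h2]⟩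
    -- Two slots are excited but only `e k'` has been replaced, so one of the excited slots `m`
    -- still has its `e m`.
    by_cases hk : Fin.castLE hL i = k'
    · exact d.apply_update (m := Fin.castLE hL k) (by rw [← hk]; simpa using hik.symm)
        fun n => (hx n).imp_left fun h => h.2
    · exact d.apply_update hk fun n => (hx n).imp_left fun h => ⟨h.1, h.2.2⟩
  q_apply := by
    rw [map_sum]
    refine Finset.sum_eq_zero fun k' _ => ?_
    have h01 : Fin.castLE hL 0 ≠ Fin.castLE hL 1 := by simp
    have h12 : Fin.castLE hL 1 ≠ Fin.castLE hL 2 := by simp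
    have h02 : Fin.castLE hL 0 ≠ Fin.castLE hL 2 := by simp
    have hx : ∀ n, (n ≠ Fin.castLE hL 0 ∧ n ≠ Fin.castLE hL 1 ∧ Function.update (Function.update
        (Function.update φ (Fin.castLE hL 0) (χ 0)) (Fin.castLE hL 1) (χ 1)) (Fin.castLE hL 2)
        (χ 2) n = φ n) ∨ ∃ j', Function.update (Function.update (Function.update φ
        (Fin.castLE hL 0) (χ 0)) (Fin.castLE hL 1) (χ 1)) (Fin.castLE hL 2) (χ 2) n = χ j' := by
      intro n
      by_cases h2 : n = Fin.castLE hL 2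
      · exact Or.inr ⟨2, by simp [h2]⟩
      · by_cases h1 : n = Fin.castLE hL 1
        · exact Or.inr ⟨1, by rw [Function.update_of_ne h2, h1, Function.update_self]⟩
        · by_cases h0 : n = Fin.castLE hL 0
          · exact Or.inr ⟨0, by
              rw [Function.update_of_ne h2, Function.update_of_ne h1, h0, Function.update_self]⟩
          · exact Or.inl ⟨h0, h1, by simp [h0, h1, h2]⟩
    by_cases hk : Fin.castLE hL 0 = k'
    · exact d.apply_update (m := Fin.castLE hL 1) (hk ▸ h01.symm)
        fun n => (hx n).imp_left fun h => h.2
    · exact d.apply_update hk fun n => (hx n).imp_left fun h => ⟨h.1, h.2.2⟩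

end FermionicDual

theorem exists_fermionicDual [FiniteDimensional ℂ V] (hL : 3 ≤ L)
    (hV : L + 3 ≤ Module.finrank ℂ V) : ∃ (e f : Fin L → V) (φ : Fin L → Module.Dual ℂ V)
      (χ : Fin 3 → Module.Dual ℂ V), FermionicDual hL e f φ χ := by
  obtain ⟨v, hv⟩ := exists_linearIndependent_of_le_finrank hV
  obtain ⟨φ, hφ⟩ := hv.exists_dual
  -- Only the first three `f i` are nonzero. The state then has at most three nonzero terms, and `L
  -- + 3` independent vectors suffice.
  refine ⟨fun i => v (Fin.castAdd 3 i),
    fun i => if h : i.1 < 3 then v (Fin.natAdd L ⟨i, h⟩) else 0, fun i => φ (Fin.castAdd 3 i),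
    fun i => φ (Fin.natAdd L i), fun i => (hφ _).1, fun i j hij => (hφ _).2 _ (by simpa using hij),
    fun i j => ?_, fun i j => (hφ _).2 _ ?_, fun i => ?_, fun i j hij => ?_⟩
  · split_ifs
    · exact (hφ _).2 _ (by simp [Fin.ext_iff]; omega)
    · simp
  · simp [Fin.ext_iff]; omega
  · simp [(hφ _).1]
  · have : (Fin.natAdd L i) ≠ Fin.natAdd L j := by simpa using hij
    simp [(hφ _).2 _ this]

theorem grassmann_exceptional [FiniteDimensional ℂ V] (hL : 3 ≤ L)
    (hV : L + 3 ≤ Module.finrank ℂ V) :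
    ∃ p : ℙ ℂ (⋀[ℂ]^L V), IsExceptional (grassmannVariety L V) p ∧
      stateBorderRank (grassmannVariety L V) p < stateRank (grassmannVariety L V) p ∧
      p ∈ secantVariety (grassmannVariety L V) 2 := by
  obtain ⟨e, f, φ, χ, d⟩ := exists_fermionicDual hL hV
  rw [grassmannVariety_eq]
  refine d.wCoordinates.exceptional (isSpanningCone_decomposableVectors (by omega)) (by omega)
    (exteriorPower.ιMulti ℂ L).toMultilinearMap e f (fun t => ⟨_, rfl⟩) (fun t h => ?_) rfl
  have := d.apply_add_smul t
  rw [show exteriorPower.ιMulti ℂ L (e + t • f) = 0 from h, map_zero] at this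
  exact zero_ne_one this

/-- Each term replaces one factor of `v 0 ∧ v 1 ∧ v 2`. The signs come from a transposition in the
middle term and a cyclic permutation in the one with `v 5`. -/
theorem fermionicWState_eq (v : Fin 6 → V) : fermionicWState v =
    ∑ k, exteriorPower.ιMulti ℂ 3
      (Function.update ![v 0, v 1, v 2] k (![v 5, v 4, v 3] k)) := by
  have h1 : exteriorPower.ιMulti ℂ 3 ![v 0, v 4, v 2] =
      -exteriorPower.ιMulti ℂ 3 ![v 0, v 2, v 4] := by
    rw [← AlternatingMap.map_swap _ _ (show (1 : Fin 3) ≠ 2 by decide)]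
    congr 1
    ext i
    fin_cases i <;> rfl
  have h2 : exteriorPower.ιMulti ℂ 3 ![v 5, v 1, v 2] =
      exteriorPower.ιMulti ℂ 3 ![v 1, v 2, v 5] := by
    rw [← neg_neg (exteriorPower.ιMulti ℂ 3 ![v 1, v 2, v 5]),
      ← AlternatingMap.map_swap _ _ (show (0 : Fin 3) ≠ 2 by decide),
      ← AlternatingMap.map_swap _ _ (show (1 : Fin 3) ≠ 2 by decide)]
    congr 1
    ext i
    fin_cases i <;> rfl
  have e0 : Function.update ![v 0, v 1, v 2] 0 (v 5) = ![v 5, v 1, v 2] := by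
    ext i; fin_cases i <;> rfl
  have e1 : Function.update ![v 0, v 1, v 2] 1 (v 4) = ![v 0, v 4, v 2] := by
    ext i; fin_cases i <;> rfl
  have e2 : Function.update ![v 0, v 1, v 2] 2 (v 3) = ![v 0, v 1, v 3] := by
    ext i; fin_cases i <;> rfl
  rw [Fin.sum_univ_three]
  simp only [Matrix.cons_val, e0, e1, e2, h1, h2, fermionicWState]
  abel

theorem grassmann_fermionicWState (v : Fin 6 → V) (hv : LinearIndependent ℂ v) :
    ∃ h : fermionicWState v ≠ 0,
      stateRank (grassmannVariety 3 V) (Projectivization.mk ℂ (fermionicWState v) h) = 3 ∧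
      stateBorderRank (grassmannVariety 3 V) (Projectivization.mk ℂ (fermionicWState v) h) = 2 := by
  obtain ⟨φ, hφ⟩ := hv.exists_dual
  have d : FermionicDual le_rfl ![v 0, v 1, v 2] ![v 5, v 4, v 3] ![φ 0, φ 1, φ 2]
      ![φ 5, φ 4, φ 3] := by
    constructor
    · intro i
      fin_cases i <;> exact (hφ _).1
    · intro i j hij
      fin_cases i <;> fin_cases j <;>
        first | exact absurd rfl hij | exact (hφ _).2 _ (by decide)
    · intro i j
      fin_cases i <;> fin_cases j <;> exact (hφ _).2 _ (by decide)
    · intro i j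
      fin_cases i <;> fin_cases j <;> exact (hφ _).2 _ (by decide)
    · intro i
      fin_cases i <;> exact (hφ _).1
    · intro i j hij
      fin_cases i <;> fin_cases j <;>
        first | exact absurd rfl hij | exact (hφ _).2 _ (by decide)
  have w := d.wCoordinates
  have hC := isSpanningCone_decomposableVectors (L := 3) (V := V) (by omega)
  rw [grassmannVariety_eq, fermionicWState_eq]
  refine ⟨w.ne_zero, le_antisymm (hC.stateRank_le _ ⟨_, fun k => ⟨⟨_, rfl⟩, fun h => ?_⟩, rfl⟩)
    (w.three_le_stateRank hC), (w.tangent hC (by omega)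
    (exteriorPower.ιMulti ℂ 3).toMultilinearMap _ _ (fun t => ⟨_, rfl⟩) (fun t h => ?_) rfl).1⟩
  · have := d.apply_update_self k
    rw [Fin.castLE_rfl, id, h, map_zero] at this
    exact zero_ne_one this
  · have := d.apply_add_smul t
    rw [show exteriorPower.ιMulti ℂ 3 (_ + t • _) = 0 from h, map_zero] at this
    exact zero_ne_one this

end Grassmann

/-! ### Symmetric powers and polarization -/

section SymmetricPowers

variable {ι : Type} {V W : Type*} [AddCommGroup V] [Module ℂ V] [AddCommGroup W] [Module ℂ W]

/-- The linear map on the symmetric power induced by a symmetric multilinear map. -/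
noncomputable def SymmetricPower.lift (g : MultilinearMap ℂ (fun _ : ι => V) W)
    (hg : ∀ (σ : Equiv.Perm ι) (v : ι → V), g (fun i => v (σ i)) = g v) :
    SymmetricPower ℂ ι V →ₗ[ℂ] W where
  __ := AddCon.lift _ (PiTensorProduct.lift g).toAddMonoidHom <| by
    refine AddCon.addConGen_le.2 ?_
    rintro _ _ ⟨σ, v⟩
    rw [AddCon.ker_apply, LinearMap.toAddMonoidHom_coe, PiTensorProduct.lift.tprod, PiTensorProduct.lift.tprod, hg]
  map_smul' a x := by
    induction x using AddCon.induction_on with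
    | H x => exact (PiTensorProduct.lift g).map_smul a x

theorem SymmetricPower.lift_tprod (g : MultilinearMap ℂ (fun _ : ι => V) W)
    (hg : ∀ (σ : Equiv.Perm ι) (v : ι → V), g (fun i => v (σ i)) = g v) (v : ι → V) :
    SymmetricPower.lift g hg (SymmetricPower.tprod ℂ v) = g v :=
  PiTensorProduct.lift.tprod v

variable [Fintype ι] [DecidableEq ι]

/-- Polarization of a multilinear map, symmetric or not. -/
theorem MultilinearMap.sum_neg_one_pow_card_smul_map_sum (g : MultilinearMap ℂ (fun _ : ι => V) W)
    (v : ι → V) : ∑ S : Finset ι, (-1 : ℂ) ^ Sᶜ.card • g (fun _ => ∑ j ∈ S, v j) =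
      ∑ σ : Equiv.Perm ι, g (fun i => v (σ i)) := by
  have h1 : ∀ S : Finset ι, g (fun _ => ∑ j ∈ S, v j) =
      ∑ r : ι → ι, (if ∀ i, r i ∈ S then (1 : ℂ) else 0) • g (fun i => v (r i)) := by
    intro S
    rw [g.map_sum_finset (fun _ j => v j) (fun _ => S)]
    simp only [ite_smul, one_smul, zero_smul]
    rw [← Finset.sum_filter]
    refine Finset.sum_congr ?_ fun _ _ => rfl
    ext r
    simp
  have h2 : ∀ r : ι → ι, ∑ S : Finset ι, (-1 : ℂ) ^ Sᶜ.card *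
      (if ∀ i, r i ∈ S then (1 : ℂ) else 0) = if Function.Surjective r then 1 else 0 := by
    intro r
    -- The alternating sum over the `S` containing the range of `r` factors over `j`: a point of the
    -- range contributes `1 + 0`, any other point `1 - 1`. Only surjective `r`, that is
    -- permutations, survive.
    have h3 := Fintype.prod_add (fun _ : ι => (1 : ℂ))
      (fun j => if ∃ i, r i = j then (0 : ℂ) else -1)
    trans ∏ j, ((1 : ℂ) + if ∃ i, r i = j then (0 : ℂ) else -1)
    · rw [h3]
      refine Finset.sum_congr rfl fun S _ => ?_
      rw [Finset.prod_const_one, one_mul]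
      split_ifs with hS
      · rw [mul_one, ← Finset.prod_const]
        refine (Finset.prod_congr rfl fun j hj => if_neg ?_).symm
        rintro ⟨i, rfl⟩
        exact Finset.mem_compl.1 hj (hS i)
      · push Not at hS
        obtain ⟨i, hi⟩ := hS
        rw [mul_zero]
        refine (Finset.prod_eq_zero (i := r i) (Finset.mem_compl.2 hi) ?_).symm
        exact if_pos ⟨i, rfl⟩
    · split_ifs with hr
      · exact Finset.prod_eq_one fun j _ => by rw [if_pos (hr j), add_zero]
      · obtain ⟨j, hj⟩ := not_forall.1 hr
        exact Finset.prod_eq_zero (Finset.mem_univ j) (by rw [if_neg hj]; ring)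
  simp only [h1, Finset.smul_sum, smul_smul]
  rw [Finset.sum_comm]
  simp only [← Finset.sum_smul, h2, ite_smul, one_smul, zero_smul]
  rw [← Finset.sum_filter]
  symm
  refine Finset.sum_bij (fun σ _ => ⇑σ) (fun σ _ => by simpa using σ.surjective)
    (fun σ _ τ _ h => Equiv.coe_fn_injective h) (fun r hr => ?_) (fun _ _ => rfl)
  have hr' : Function.Bijective r :=
    Finite.surjective_iff_bijective.1 (by simpa using hr)
  exact ⟨Equiv.ofBijective r hr', Finset.mem_univ _, rfl⟩

/-- For the symmetric map `tprod`, the right side of the polarization identity is a factorial times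
`tprod v`, and the factorial is invertible in `ℂ`. -/
theorem SymmetricPower.span_tprod_const :
    Submodule.span ℂ (Set.range fun v : V => SymmetricPower.tprod ℂ (fun _ : ι => v)) = ⊤ := by
  rw [eq_top_iff, ← SymmetricPower.span_tprod_eq_top, Submodule.span_le]
  rintro _ ⟨v, rfl⟩
  have h := (SymmetricPower.tprod ℂ (ι := ι) (M := V)).sum_neg_one_pow_card_smul_map_sum v
  simp only [SymmetricPower.tprod_equiv, Finset.sum_const, Finset.card_univ, Fintype.card_perm] at h
  have h0 : (((Fintype.card ι).factorial : ℕ) : ℂ) ≠ 0 := by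
    exact_mod_cast Nat.factorial_ne_zero _
  have h1 : SymmetricPower.tprod ℂ v = (((Fintype.card ι).factorial : ℕ) : ℂ)⁻¹ •
      ∑ S : Finset ι, (-1 : ℂ) ^ Sᶜ.card • SymmetricPower.tprod ℂ fun _ => ∑ j ∈ S, v j := by
    rw [h, ← Nat.cast_smul_eq_nsmul ℂ, inv_smul_smul₀ h0]
  rw [h1]
  exact Submodule.smul_mem _ _ (Submodule.sum_mem _ fun S _ => Submodule.smul_mem _ _
    (Submodule.subset_span ⟨_, rfl⟩))

end SymmetricPowers

/-! ### Waring rank of a binary form -/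

section PowerSums

open Polynomial

theorem coeff_binary_pow (α β : ℂ) (L k : ℕ) :
    ((C β + C α * X) ^ L).coeff k = α ^ k * β ^ (L - k) * (L.choose k : ℂ) := by
  have h : (C β + C α * X) ^ L = ∑ i ∈ Finset.range (L + 1),
      C (α ^ i * β ^ (L - i) * (L.choose i : ℂ)) * X ^ i := by
    rw [add_comm, add_pow]
    refine Finset.sum_congr rfl fun i _ => ?_
    simp only [mul_pow, C_mul, C_pow, C_eq_natCast]
    ring
  rw [h, finsetSum_coeff]
  simp only [coeff_C_mul_X_pow]
  rw [Finset.sum_ite_eq, ite_eq_left_iff, Finset.mem_range]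
  intro hk
  rw [Nat.choose_eq_zero_of_lt (by omega), Nat.cast_zero, mul_zero]

/-- The Waring rank of the binary form `x y ^ (L - 1)` is at least `L`. -/
theorem le_of_sum_pow_eq_X {L r : ℕ} (hL : 1 ≤ L) (α β : Fin r → ℂ)
    (h : ∑ j, (C (β j) + C (α j) * X) ^ L = X) : L ≤ r := by
  by_contra! hr
  have hcoeff : ∀ k, k ≤ L → ∑ j, α j ^ k * β j ^ (L - k) * (L.choose k : ℂ) =
      if k = 1 then 1 else 0 := by
    intro k hk
    have := congrArg (fun p => coeff p k) h
    simp only [finsetSum_coeff, coeff_X] at this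
    rw [if_congr (eq_comm (a := k) (b := 1)) rfl rfl, ← this]
    refine Finset.sum_congr rfl fun j _ => ?_
    rw [coeff_binary_pow]
  set J := Finset.univ.filter fun j => α j ≠ 0 with hJ
  have hJr : J.card ≤ r := by simpa using J.card_le_univ
  -- This is the coefficient of `X ^ (L - m)` divided by its binomial. Since `L - m ≥ 1`, terms with
  -- `α j = 0` do not contribute. The value `1 / L` comes from `L.choose 1`.
  have hmom : ∀ m, m ≤ L - 1 → ∑ j ∈ J, α j ^ L * (β j / α j) ^ m =
      if m = L - 1 then (L : ℂ)⁻¹ else 0 := by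
    intro m hm
    have h1 := hcoeff (L - m) (by omega)
    have h2 : ∑ j, α j ^ (L - m) * β j ^ (L - (L - m)) * (L.choose (L - m) : ℂ) =
        (∑ j ∈ J, α j ^ L * (β j / α j) ^ m) * (L.choose (L - m) : ℂ) := by
      rw [Finset.sum_mul, hJ, Finset.sum_filter]
      refine Finset.sum_congr rfl fun j _ => ?_
      split_ifs with hj
      · rw [show L - (L - m) = m by omega, div_pow]
        congr 1
        have h4 : α j ^ L = α j ^ (L - m) * α j ^ m := by rw [← pow_add]; congr 1; omega
        rw [h4, mul_assoc, mul_div_cancel₀ _ (pow_ne_zero m hj)]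
      · rw [not_not] at hj
        rw [hj, zero_pow (by omega), zero_mul, zero_mul]
    rw [h2] at h1
    have h3 : ((L.choose (L - m) : ℕ) : ℂ) ≠ 0 := by
      exact_mod_cast (Nat.choose_pos (Nat.sub_le L m)).ne'
    rw [eq_div_of_mul_eq h3 h1]
    by_cases hm' : m = L - 1
    · subst hm'
      rw [show L - (L - 1) = 1 by omega]
      simp
    · rw [if_neg hm', if_neg (by omega), zero_div]
  -- As `J.card ≤ r ≤ L - 1`, some monic polynomial of degree exactly `L - 1` vanishes at all nodes
  -- `β j / α j`. Its weighted sum over the nodes is `0`, whereas the moments give `1 / L`.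
  set g : ℂ[X] := X ^ (L - 1 - J.card) * ∏ j ∈ J, (X - C (β j / α j)) with hg
  have hmonic : g.Monic := (monic_X_pow _).mul (monic_prod_of_monic _ _ fun j _ => monic_X_sub_C _)
  have hdeg : g.natDegree = L - 1 := by
    rw [hg, (monic_X_pow _).natDegree_mul (monic_prod_of_monic _ _ fun j _ => monic_X_sub_C _),
      natDegree_X_pow, natDegree_prod_of_monic _ _ fun j _ => monic_X_sub_C _]
    simp
    omega
  have hz : ∑ j ∈ J, α j ^ L * g.eval (β j / α j) = 0 := by
    refine Finset.sum_eq_zero fun j hj => ?_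
    rw [hg, eval_mul, eval_prod, Finset.prod_eq_zero hj (by simp), mul_zero, mul_zero]
  have hz' : ∑ j ∈ J, α j ^ L * g.eval (β j / α j) = (L : ℂ)⁻¹ := by
    simp only [eval_eq_sum_range, hdeg, Finset.mul_sum]
    rw [Finset.sum_comm]
    have : ∀ m ∈ Finset.range (L - 1 + 1), ∑ j ∈ J, α j ^ L * (g.coeff m * (β j / α j) ^ m) =
        if m = L - 1 then (L : ℂ)⁻¹ else 0 := by
      intro m hm
      rw [Finset.mem_range] at hm
      have h1 : ∑ j ∈ J, α j ^ L * (g.coeff m * (β j / α j) ^ m) =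
          g.coeff m * ∑ j ∈ J, α j ^ L * (β j / α j) ^ m := by
        rw [Finset.mul_sum]
        exact Finset.sum_congr rfl fun j _ => by ring
      rw [h1, hmom m (by omega)]
      split_ifs with hm'
      · rw [hm', ← hdeg, hmonic.coeff_natDegree, one_mul]
      · rw [mul_zero]
    rw [Finset.sum_congr rfl this]
    simp
  rw [hz] at hz'
  exact inv_ne_zero (by exact_mod_cast (by omega : L ≠ 0)) hz'.symm

end PowerSums

/-! ### Bosons: the Veronese variety -/

section Veronese

variable {L : ℕ} {V : Type*} [AddCommGroup V] [Module ℂ V]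

/-- The `L`-th powers of vectors. -/
def powerVectors (L : ℕ) (V : Type*) [AddCommGroup V] [Module ℂ V] :
    Set (SymmetricPower ℂ (Fin L) V) :=
  Set.range fun v : V => SymmetricPower.tprod ℂ (fun _ : Fin L => v)

theorem veroneseVariety_eq : veroneseVariety L V = projectivized (powerVectors L V) := by
  ext p
  constructor
  · rintro ⟨v, h, rfl⟩
    exact ⟨_, h, ⟨v, rfl⟩, rfl⟩
  · rintro ⟨_, h, ⟨v, rfl⟩, rfl⟩
    exact ⟨v, h, rfl⟩

theorem isSpanningCone_powerVectors (hL : 1 ≤ L) : IsSpanningCone (powerVectors L V) where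
  smul_mem := by
    rintro a _ ⟨v, rfl⟩
    -- A scalar is absorbed into `v` by taking an `L`-th root.
    obtain ⟨b, rfl⟩ := IsAlgClosed.exists_pow_nat_eq a hL
    refine ⟨b • v, ?_⟩
    have := (SymmetricPower.tprod ℂ (ι := Fin L) (M := V)).map_smul_univ (fun _ => b) fun _ => v
    simpa using this
  span_eq_top := SymmetricPower.span_tprod_const

open Polynomial

/-- The multilinear map sending `v` to the product of the polynomials `φ (v i) + χ (v i) X`. -/
noncomputable def binaryForm (L : ℕ) (φ χ : Module.Dual ℂ V) :
    SymmetricPower ℂ (Fin L) V →ₗ[ℂ] ℂ[X] :=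
  SymmetricPower.lift ((MultilinearMap.mkPiAlgebra ℂ (Fin L) ℂ[X]).compLinearMap
    fun _ => LinearMap.smulRight φ 1 + LinearMap.smulRight χ X)
    fun σ v => by
      simp only [MultilinearMap.compLinearMap_apply, MultilinearMap.mkPiAlgebra_apply]
      exact Equiv.prod_comp σ fun i => φ (v i) • (1 : ℂ[X]) + χ (v i) • X

theorem binaryForm_tprod (φ χ : Module.Dual ℂ V) (v : Fin L → V) :
    binaryForm L φ χ (SymmetricPower.tprod ℂ v) = ∏ i, (C (φ (v i)) + C (χ (v i)) * X) := by
  rw [binaryForm, SymmetricPower.lift_tprod]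
  simp [smul_eq_C_mul]

theorem binaryForm_tprod_const (φ χ : Module.Dual ℂ V) (v : V) :
    binaryForm L φ χ (SymmetricPower.tprod ℂ fun _ => v) = (C (φ v) + C (χ v) * X) ^ L := by
  simp [binaryForm_tprod]

variable {u w : V} {φ χ : Module.Dual ℂ V}

theorem binaryForm_bosonicWState (hL : 1 ≤ L) (hφu : φ u = 0) (hφw : φ w = 1) (hχu : χ u = 1)
    (hχw : χ w = 0) : binaryForm L φ χ (bosonicWState L u w) = X := by
  obtain ⟨n, rfl⟩ : ∃ n, L = n + 1 := ⟨L - 1, by omega⟩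
  simp [bosonicWState, binaryForm_tprod, Fin.prod_univ_succ, *]

theorem tprod_update_eq_bosonicWState (k : Fin L) (u w : V) :
    SymmetricPower.tprod ℂ (Function.update (fun _ : Fin L => w) k u) = bosonicWState L u w := by
  have hL := k.pos
  rw [← SymmetricPower.tprod_equiv (Equiv.swap k ⟨0, hL⟩), bosonicWState]
  congr 1
  ext i
  rw [Function.update_apply]
  refine if_congr ?_ rfl rfl
  rw [Equiv.swap_apply_eq_iff, Equiv.swap_apply_left, Fin.ext_iff]

theorem sum_tprod_update (u w : V) :
    ∑ k : Fin L, SymmetricPower.tprod ℂ (Function.update (fun _ : Fin L => w) k u) =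
      (L : ℂ) • bosonicWState L u w := by
  simp [tprod_update_eq_bosonicWState, Nat.cast_smul_eq_nsmul]

theorem tprod_const_add_smul_ne_zero (hφu : φ u = 0) (hφw : φ w = 1) (t : ℂ) :
    SymmetricPower.tprod ℂ (fun _ : Fin L => w + t • u) ≠ 0 := by
  intro h
  have h1 := binaryForm_tprod_const (L := L) φ 0 (w + t • u)
  rw [h] at h1
  simp [hφu, hφw] at h1

/-- Averaging `(w + t u)^L` over the `L`-th roots of unity `t` with weight `t^(L-1)` keeps only the
coefficient of `t`, which is `L u w^(L-1)`. One factor `1 / L` in the weights cancels this `L`, the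
other cancels the number of roots. -/
theorem isSumOf_bosonicWState (hL : 2 ≤ L) (hφu : φ u = 0) (hφw : φ w = 1) :
    IsSumOf (powerVectors L V) L (bosonicWState L u w) := by
  have hL0 : L ≠ 0 := by omega
  have hω := Complex.isPrimitiveRoot_exp L hL0
  set ω := Complex.exp (2 * Real.pi * Complex.I / L)
  have hLc : (L : ℂ) ≠ 0 := by exact_mod_cast hL0
  have hC := isSpanningCone_powerVectors (L := L) (V := V) (by omega)
  refine ⟨fun j => ((L : ℂ)⁻¹ * (L : ℂ)⁻¹ * (ω ^ (j : ℕ)) ^ (L - 1)) •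
    SymmetricPower.tprod ℂ (fun _ : Fin L => w + ω ^ (j : ℕ) • u), fun j => ⟨hC.smul_mem _ _ ⟨_, rfl⟩,
    smul_ne_zero (mul_ne_zero (mul_ne_zero (inv_ne_zero hLc) (inv_ne_zero hLc))
      (pow_ne_zero _ (pow_ne_zero _ (hω.ne_zero hL0)))) (tprod_const_add_smul_ne_zero hφu hφw _)⟩, ?_⟩
  set M := SymmetricPower.tprod ℂ (ι := Fin L) (M := V)
  have h1 : ∀ t : ℂ, M (fun _ => w + t • u) =
      ∑ i ∈ Finset.range (L + 1), t ^ i • M.curveCoeff (fun _ => w) (fun _ => u) i :=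
    fun t => M.map_add_smul_eq_sum (fun _ => w) (fun _ => u) t
  -- For `0 ≤ i ≤ L` and `2 ≤ L`, the exponent `L - 1 + i` is a multiple of `L` only when `i = 1`.
  have h2 : ∀ i ∈ Finset.range (L + 1), ∑ j : Fin L, (ω ^ (j : ℕ)) ^ (L - 1) * (ω ^ (j : ℕ)) ^ i =
      if i = 1 then (L : ℂ) else 0 := by
    intro i hi
    rw [Finset.mem_range] at hi
    have h3 : ∀ j : ℕ, (ω ^ j) ^ (L - 1) * (ω ^ j) ^ i = (ω ^ (L - 1 + i)) ^ j := by
      intro j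
      rw [← pow_add, ← pow_mul, ← pow_mul, mul_comm]
    simp only [h3]
    rw [Fin.sum_univ_eq_sum_range (fun j => (ω ^ (L - 1 + i)) ^ j)]
    split_ifs with h
    · rw [h, show L - 1 + 1 = L by omega, hω.pow_eq_one]
      simp
    · have hne : ω ^ (L - 1 + i) ≠ 1 := by
        intro h'
        obtain ⟨m, hm⟩ := (hω.pow_eq_one_iff_dvd _).1 h'
        have : m < 2 := by
          by_contra! hm2
          have := Nat.mul_le_mul_left L hm2
          omega
        interval_cases m <;> omega
      have := mul_geom_sum (ω ^ (L - 1 + i)) L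
      rw [← pow_mul ω, mul_comm (L - 1 + i), pow_mul, hω.pow_eq_one, one_pow, sub_self] at this
      exact (mul_eq_zero.1 this).resolve_left (sub_ne_zero.2 hne)
  simp only [h1, mul_smul, ← Finset.smul_sum]
  simp only [Finset.smul_sum, smul_smul]
  rw [Finset.sum_comm]
  simp only [← Finset.sum_smul, ← Finset.mul_sum]
  rw [Finset.sum_congr rfl fun i hi => by rw [h2 i hi]]
  rw [Finset.sum_eq_single 1 (fun i _ hi => by simp [hi])
    (fun h => absurd (Finset.mem_range.2 (by omega)) h)]
  rw [M.curveCoeff_one, sum_tprod_update, smul_smul, if_pos rfl]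
  field_simp
  simp

theorem IsSumOf.le_of_bosonicWState (hL : 1 ≤ L) (hφu : φ u = 0) (hφw : φ w = 1)
    (hχu : χ u = 1) (hχw : χ w = 0) {r : ℕ}
    (h : IsSumOf (powerVectors L V) r (bosonicWState L u w)) : L ≤ r := by
  obtain ⟨x, hx, hs⟩ := h
  choose v hv using fun j => (hx j).1
  refine le_of_sum_pow_eq_X hL (fun j => χ (v j)) (fun j => φ (v j)) ?_
  refine Eq.trans ?_ (binaryForm_bosonicWState hL hφu hφw hχu hχw)
  rw [← hs, map_sum]
  exact Finset.sum_congr rfl fun j _ => by rw [← hv, binaryForm_tprod_const]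

theorem veronese_bosonicWState (hL : 3 ≤ L) (h : LinearIndependent ℂ ![u, w]) :
    ∃ h : bosonicWState L u w ≠ 0,
      stateRank (veroneseVariety L V) (Projectivization.mk ℂ (bosonicWState L u w) h) = L ∧
      stateBorderRank (veroneseVariety L V) (Projectivization.mk ℂ (bosonicWState L u w) h) = 2 ∧
      Projectivization.mk ℂ (bosonicWState L u w) h ∈ secantVariety (veroneseVariety L V) 2 := by
  obtain ⟨χ, φ, hχu, hχw, hφu, hφw⟩ := exists_dual_pair h
  have hC := isSpanningCone_powerVectors (L := L) (V := V) (by omega)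
  have hB := binaryForm_bosonicWState (L := L) (by omega) hφu hφw hχu hχw
  have hLc : (L : ℂ) ≠ 0 := by exact_mod_cast (by omega : L ≠ 0)
  rw [veroneseVariety_eq]
  have h0 : bosonicWState L u w ≠ 0 := by
    intro h0
    rw [h0, map_zero] at hB
    exact X_ne_zero hB.symm
  refine ⟨h0, le_antisymm (hC.stateRank_le _ (isSumOf_bosonicWState (by omega) hφu hφw))
    (hC.le_stateRank _ fun r hr => hr.le_of_bosonicWState (by omega) hφu hφw hχu hχw), ?_⟩
  let c : ℕ → Module.Dual ℂ (SymmetricPower ℂ (Fin L) V) := fun k => lcoeff ℂ k ∘ₗ binaryForm L φ χ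
  have hX := fun f : Module.Dual ℂ (SymmetricPower ℂ (Fin L) V) => MvPolynomial.isHomogeneous_X ℂ f
  -- The direction is `u / L` because the velocity in direction `u` is `L u w^(L-1)`. The quadric is
  -- the relation `(L choose 2) c₁² = L² c₀ c₂` between the lowest coefficients of `(β + α X)^L`. It
  -- fails for the polynomial `X`, where `c₁ = 1` and `c₀ = c₂ = 0`.
  refine hC.multilinear_tangent (d := 2) (by omega) (SymmetricPower.tprod ℂ (ι := Fin L) (M := V))
    (fun _ => w) (fun _ => (L : ℂ)⁻¹ • u) (fun t => ⟨w + t • (L : ℂ)⁻¹ • u, rfl⟩) (fun t => ?_)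
    (F := MvPolynomial.X ((L.choose 2 : ℂ) • c 1) * MvPolynomial.X (c 1) -
      MvPolynomial.X ((L : ℂ) ^ 2 • c 0) * MvPolynomial.X (c 2))
    (((hX _).mul (hX _)).sub ((hX _).mul (hX _))) ?_ ?_ ?_ h0
  · have := tprod_const_add_smul_ne_zero (L := L) hφu hφw (t * (L : ℂ)⁻¹)
    rwa [mul_smul] at this
  · rintro _ ⟨v, rfl⟩
    simp only [polyValue, map_sub, map_mul, MvPolynomial.eval_X, LinearMap.smul_apply, smul_eq_mul, c,
      LinearMap.comp_apply, lcoeff_apply, binaryForm_tprod_const, coeff_binary_pow]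
    obtain ⟨n, rfl⟩ : ∃ n, L = n + 2 := ⟨L - 2, by omega⟩
    simp only [Nat.choose_one_right, Nat.choose_zero_right, show n + 2 - 1 = n + 1 by omega,
      Nat.add_sub_cancel, Nat.sub_zero]
    push_cast
    ring
  · have h1 := fun k => (SymmetricPower.tprod ℂ (ι := Fin L) (M := V)).map_update_smul
      (fun _ => w) k (L : ℂ)⁻¹ u
    simp only [h1, ← Finset.smul_sum, sum_tprod_update, inv_smul_smul₀ hLc]
  · have : (L.choose 2 : ℂ) ≠ 0 := by
      exact_mod_cast (Nat.choose_pos (by omega : 2 ≤ L)).ne'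
    simpa [polyValue, c, hB, coeff_X] using this

theorem veronese_exceptional (hL : 3 ≤ L) (hV : 2 ≤ Module.finrank ℂ V) :
    ∃ p : ℙ ℂ (SymmetricPower ℂ (Fin L) V), IsExceptional (veroneseVariety L V) p ∧
      stateBorderRank (veroneseVariety L V) p < stateRank (veroneseVariety L V) p ∧
      p ∈ secantVariety (veroneseVariety L V) 2 := by
  obtain ⟨u, w, huw⟩ := exists_linearIndependent_pair_of_finrank hV
  obtain ⟨h, h1, h2, h3⟩ := veronese_bosonicWState hL huw
  refine ⟨_, ?_, ?_, h3⟩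
  · unfold IsExceptional
    omega
  · omega

end Veronese

theorem mainTheorem2 :
    -- distinguishable particles
    ((∀ (L : ℕ) (H : Fin L → Type*) [∀ j, AddCommGroup (H j)] [∀ j, Module ℂ (H j)]
        [∀ j, FiniteDimensional ℂ (H j)],
        3 ≤ L → (∀ j, 2 ≤ Module.finrank ℂ (H j)) →
        ∃ p : ℙ ℂ (⨂[ℂ] j, H j),
          IsExceptional (segreVariety H) p ∧
          stateBorderRank (segreVariety H) p < stateRank (segreVariety H) p ∧
          p ∈ secantVariety (segreVariety H) 2) ∧
      (∀ (H : Fin 3 → Type*) [∀ j, AddCommGroup (H j)] [∀ j, Module ℂ (H j)]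
        [∀ j, FiniteDimensional ℂ (H j)] (e f : ∀ j, H j),
        (∀ j, LinearIndependent ℂ ![e j, f j]) →
        ∃ h : wState e f ≠ 0,
          stateRank (segreVariety H) (Projectivization.mk ℂ (wState e f) h) = 3 ∧
          stateBorderRank (segreVariety H) (Projectivization.mk ℂ (wState e f) h) = 2)) ∧
    -- bosons
    ((∀ (L : ℕ) (V : Type*) [AddCommGroup V] [Module ℂ V] [FiniteDimensional ℂ V],
        3 ≤ L → 2 ≤ Module.finrank ℂ V →
        ∃ p : ℙ ℂ (SymmetricPower ℂ (Fin L) V),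
          IsExceptional (veroneseVariety L V) p ∧
          stateBorderRank (veroneseVariety L V) p < stateRank (veroneseVariety L V) p ∧
          p ∈ secantVariety (veroneseVariety L V) 2) ∧
      (∀ (L : ℕ) (V : Type*) [AddCommGroup V] [Module ℂ V] [FiniteDimensional ℂ V] (u w : V),
        3 ≤ L → LinearIndependent ℂ ![u, w] →
        ∃ h : bosonicWState L u w ≠ 0,
          stateRank (veroneseVariety L V)
            (Projectivization.mk ℂ (bosonicWState L u w) h) = L ∧
          stateBorderRank (veroneseVariety L V)
            (Projectivization.mk ℂ (bosonicWState L u w) h) = 2)) ∧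
    -- fermions
    ((∀ (L : ℕ) (V : Type*) [AddCommGroup V] [Module ℂ V] [FiniteDimensional ℂ V],
        3 ≤ L → L + 3 ≤ Module.finrank ℂ V →
        ∃ p : ℙ ℂ (⋀[ℂ]^L V),
          IsExceptional (grassmannVariety L V) p ∧
          stateBorderRank (grassmannVariety L V) p < stateRank (grassmannVariety L V) p ∧
          p ∈ secantVariety (grassmannVariety L V) 2) ∧
      (∀ (V : Type*) [AddCommGroup V] [Module ℂ V] [FiniteDimensional ℂ V] (v : Fin 6 → V),
        LinearIndependent ℂ v →
        ∃ h : fermionicWState v ≠ 0,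
          stateRank (grassmannVariety 3 V)
            (Projectivization.mk ℂ (fermionicWState v) h) = 3 ∧
          stateBorderRank (grassmannVariety 3 V)
            (Projectivization.mk ℂ (fermionicWState v) h) = 2)) := by
  refine ⟨⟨fun L H _ _ _ hL hH => segre_exceptional hL hH,
    fun H _ _ _ e f hef => segre_wState e f hef⟩,
    ⟨fun L V _ _ _ hL hV => veronese_exceptional hL hV, fun L V _ _ _ u w hL huw => ?_⟩,
    ⟨fun L V _ _ _ hL hV => grassmann_exceptional hL hV,
    fun V _ _ _ v hv => grassmann_fermionicWState v hv⟩⟩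
  obtain ⟨h, h1, h2, -⟩ := veronese_bosonicWState hL huw
  exact ⟨h, h1, h2⟩
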